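/- Let $b,\sigma:[0,\infty[\to\mathbb R$ be locally Lipschitz with $\sigma(x)>0$ for all $x>0$, and let $r:[0,\infty[\to\mathbb R$ be bounded and continuous with $r\ge r_0$ for some constant $r_0>0$. Let $$p'(x)=\exp\Bigl(-2\int_1^x\frac{b(s)}{\sigma^2(s)}\,\mathrm ds\Bigr),\qquad p(1)=0,\qquad m(\mathrm dx)=\frac{2}{\sigma^2(x)p'(x)}\,\mathrm dx$$ be the scale function and the speed measure on $]0,\infty[$ of the diffusion $\mathrm dX_t=b(X_t)\,\mathrm dt+\sigma(X_t)\,\mathrm dW_t$, $X_0=x>0$. Suppose that the boundary points $0$ and $\infty$ are inaccessible, i.e. $\int_0^1 m(]y,1[)\,p'(y)\,\mathrm dy=\int_1^\infty m(]1,y[)\,p'(y)\,\mathrm dy=\infty$. The inaccessible boundary point $0$ is called an entrance boundary point if $\int_0^1(p(1)-p(y))\,m(\mathrm dy)<\infty$ and a natural boundary point if this integral is infinite. For each $x>0$ let $X$ be, under $\mathbb P_x$, a (weak) solution of the SDE in $]0,\infty[$ started from $x$, and let $\Lambda_t=\int_0^t r(X_s)\,\mathrm ds$. Let $F:\,]0,\infty[\to\mathbb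 R$ be Borel measurable with $$\mathbb E_x\Bigl[\int_0^\infty e^{-\Lambda_t}|F(X_t)|\,\mathrm dt\Bigr]<\infty\quad\text{for all }x>0,\qquad\text{and define}\qquad R_F(x)=\mathbb E_x\Bigl[\int_0^\infty e^{-\Lambda_t}F(X_t)\,\mathrm dt\Bigr],\quad x>0.$$ (i) If $K\in\mathbb R$ is such that $F(x)/r(x)\ge K$ for all $x>0$, then $R_F(x)\ge K$ for all $x>0$. (ii) If $0$ is a natural boundary point, then, in $[-\infty,\infty]$, $$\liminf_{x\downarrow0}\frac{F(x)}{r(x)}\le\liminf_{x\downarrow0}R_F(x)\le\limsup_{x\downarrow0}R_F(x)\le\limsup_{x\downarrow0}\frac{F(x)}{r(x)}.$$ (iii) The inequalities in (ii) are not true in general if $0$ is an entrance boundary point: there exist $b,\sigma,r,F$ satisfying the assumptions above on the coefficients and on the boundary points, with $0$ an entrance boundary point, such that, for every realisation of the diffusion, $F$ satisfies the integrability condition but the chain of inequalities in (ii) fails. -/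

import Mathlib

open MeasureTheory ProbabilityTheory Filter Topology Set
open scoped NNReal ENNReal

universe u

noncomputable section

namespace PosDiffusion

/-- Derivative `p'` of the scale function: `p'(x) = exp(-2 ∫₁ˣ b/σ²)`. -/
def scaleDeriv (b σ : ℝ → ℝ) (x : ℝ) : ℝ :=
  Real.exp (-2 * ∫ s in (1 : ℝ)..x, b s / σ s ^ 2)

/-- The scale function `p`, normalised by `p(1) = 0`. -/
def scale (b σ : ℝ → ℝ) (x : ℝ) : ℝ :=
  ∫ s in (1 : ℝ)..x, scaleDeriv b σ s

/-- The speed measure `m(dx) = 2 / (σ²(x) p'(x)) dx` on `]0,∞[`. -/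
def speedMeasure (b σ : ℝ → ℝ) : Measure ℝ :=
  (volume.restrict (Ioi (0 : ℝ))).withDensity
    fun x => ENNReal.ofReal (2 / (σ x ^ 2 * scaleDeriv b σ x))

/-- The boundary point `0` is inaccessible (Feller's test): `∫₀¹ m(]y,1[) p'(y) dy = ∞`. -/
def ZeroInaccessible (b σ : ℝ → ℝ) : Prop :=
  ∫⁻ y in Ioo (0 : ℝ) 1,
    ENNReal.ofReal (scaleDeriv b σ y) * speedMeasure b σ (Ioo y 1) = ⊤

/-- The boundary point `∞` is inaccessible (Feller's test): `∫₁^∞ m(]1,y[) p'(y) dy = ∞`. -/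
def InftyInaccessible (b σ : ℝ → ℝ) : Prop :=
  ∫⁻ y in Ioi (1 : ℝ),
    ENNReal.ofReal (scaleDeriv b σ y) * speedMeasure b σ (Ioo 1 y) = ⊤

/-- The boundary point `0` is an entrance boundary point: it is inaccessible and
`∫₀¹ (p(1) - p(y)) m(dy) < ∞`. -/
def ZeroEntrance (b σ : ℝ → ℝ) : Prop :=
  ZeroInaccessible b σ ∧
    ∫⁻ y in Ioo (0 : ℝ) 1, ENNReal.ofReal (scale b σ 1 - scale b σ y) ∂(speedMeasure b σ) < ⊤

/-- The boundary point `0` is a natural boundary point: it is inaccessible and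
`∫₀¹ (p(1) - p(y)) m(dy) = ∞`. -/
def ZeroNatural (b σ : ℝ → ℝ) : Prop :=
  ZeroInaccessible b σ ∧
    ∫⁻ y in Ioo (0 : ℝ) 1, ENNReal.ofReal (scale b σ 1 - scale b σ y) ∂(speedMeasure b σ) = ⊤

/-- The assumptions on the coefficients `b`, `σ` and on the discounting rate `r`. All of the
functions are only considered on `[0,∞[`; their values at negative points play no role. -/
structure Admissible (b σ r : ℝ → ℝ) : Prop where
  b_lip : LocallyLipschitzOn (Ici 0) b
  σ_lip : LocallyLipschitzOn (Ici 0) σ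
  σ_pos : ∀ x, 0 < x → 0 < σ x
  r_cont : ContinuousOn r (Ici 0)
  r_lower : ∃ r₀ : ℝ, 0 < r₀ ∧ ∀ x, 0 ≤ x → r₀ ≤ r x
  r_upper : ∃ r₁ : ℝ, ∀ x, 0 ≤ x → r x ≤ r₁
  zero_inaccessible : ZeroInaccessible b σ
  infty_inaccessible : InftyInaccessible b σ

/-- The second order operator `f ↦ ½ σ² f'' + b f'` of the SDE `dX = b(X) dt + σ(X) dW`. -/
def generator (b σ : ℝ → ℝ) (f : ℝ → ℝ) (x : ℝ) : ℝ :=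
  (1 / 2) * σ x ^ 2 * deriv (deriv f) x + b x * deriv f x

/-- On the filtered probability space `(Ω, 𝓕, P)`, the process `X` is a non-explosive weak
solution in `]0,∞[` of `dX_t = b(X_t) dt + σ(X_t) dW_t`, `X_0 = x`, in the martingale problem
formulation: `X` is adapted and continuous, it starts from `x`, and
`f(X_t) - f(X_0) - ∫₀ᵗ (½ σ² f'' + b f')(X_s) ds` is a martingale for every `C²` function `f`
with compact support in `]0,∞[`. -/
structure IsDiffusion {Ω : Type*} {mΩ : MeasurableSpace Ω} (b σ : ℝ → ℝ) (x : ℝ)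
    (𝓕 : Filtration ℝ≥0 mΩ) (P : Measure Ω)
    (X : ℝ≥0 → Ω → ℝ) : Prop where
  prob : IsProbabilityMeasure P
  adapted : StronglyAdapted 𝓕 X
  continuous_paths : ∀ ω, Continuous fun t => X t ω
  pos : ∀ t ω, 0 < X t ω
  start : ∀ᵐ ω ∂P, X 0 ω = x
  martingale : ∀ f : ℝ → ℝ, ContDiff ℝ 2 f → HasCompactSupport f → tsupport f ⊆ Ioi 0 →
    Martingale
      (fun t ω => f (X t ω) - f (X 0 ω)
        - ∫ s in (0 : ℝ)..(t : ℝ), generator b σ f (X s.toNNReal ω))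
      𝓕 P

/-- A realisation of the diffusion from each starting point `x > 0`: under `P x`, the process
`X x` solves the SDE with initial condition `x`. -/
def IsDiffusionFamily {Ω : Type*} {mΩ : MeasurableSpace Ω} (b σ : ℝ → ℝ)
    (𝓕 : ℝ → Filtration ℝ≥0 mΩ) (P : ℝ → Measure Ω)
    (X : ℝ → ℝ≥0 → Ω → ℝ) : Prop :=
  ∀ x, 0 < x → IsDiffusion b σ x (𝓕 x) (P x) (X x)

/-- The cumulative discounting rate `Λ_t = ∫₀ᵗ r(X_s) ds`. -/
def discount {Ω : Type*} (r : ℝ → ℝ) (X : ℝ≥0 → Ω → ℝ) (t : ℝ) (ω : Ω) : ℝ :=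
  ∫ s in (0 : ℝ)..t, r (X s.toNNReal ω)

/-- The integrability condition `E_x[∫₀^∞ e^{-Λ_t} |F(X_t)| dt] < ∞` for all `x > 0`. -/
def DiscountedIntegrable {Ω : Type*} [MeasurableSpace Ω] (r F : ℝ → ℝ) (P : ℝ → Measure Ω)
    (X : ℝ → ℝ≥0 → Ω → ℝ) : Prop :=
  ∀ x, 0 < x →
    ∫⁻ ω, (∫⁻ t in Ioi (0 : ℝ),
      ENNReal.ofReal (Real.exp (-discount r (X x) t ω) * |F (X x t.toNNReal ω)|)) ∂(P x) < ⊤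

/-- `R_F(x) = E_x[∫₀^∞ e^{-Λ_t} F(X_t) dt]`. -/
def resolvent {Ω : Type*} [MeasurableSpace Ω] (r F : ℝ → ℝ) (P : ℝ → Measure Ω)
    (X : ℝ → ℝ≥0 → Ω → ℝ) (x : ℝ) : ℝ :=
  ∫ ω, (∫ t in Ioi (0 : ℝ),
    Real.exp (-discount r (X x) t ω) * F (X x t.toNNReal ω)) ∂(P x)

/-- `liminf_{x↓0} g(x) ≤ liminf_{x↓0} R(x) ≤ limsup_{x↓0} R(x) ≤ limsup_{x↓0} g(x)`, where the
lower and upper limits are taken in `[-∞,∞]`. -/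
def SqueezedAtZero (g R : ℝ → ℝ) : Prop :=
  liminf (fun x => (g x : EReal)) (𝓝[>] (0 : ℝ)) ≤ liminf (fun x => (R x : EReal)) (𝓝[>] (0 : ℝ)) ∧
  liminf (fun x => (R x : EReal)) (𝓝[>] (0 : ℝ)) ≤ limsup (fun x => (R x : EReal)) (𝓝[>] (0 : ℝ)) ∧
  limsup (fun x => (R x : EReal)) (𝓝[>] (0 : ℝ)) ≤ limsup (fun x => (g x : EReal)) (𝓝[>] (0 : ℝ))

end PosDiffusion

end

/-! Everything is read off from the discounted occupation measure `G_x(A) = E_x[∫₀^∞ e^{-Λ_t}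
1_A(X_t) dt]`, for which `R_F(x) = ∫ F dG_x`. Only two identities for `G_x` are needed
(`IsDiffusion.isGreenMeasure`). The first is `∫ r dG_x = 1`, since `r(X) e^{-Λ}` is minus the
derivative of `e^{-Λ}`. The second is `∫ (r f - L f) dG_x = f(x)` for test functions `f`, where `L =
½ σ² ∂² + b ∂`. Part (i) follows by integrating `F ≥ K r`.

For (ii), let `ψ` be the positive increasing solution of `L ψ = r ψ`. Classically, the strong Markov
property at the hitting time of `δ` gives `G_x = (ψ(x)/ψ(δ)) G_δ` on `]δ,∞[` for `x ≤ δ`. Here the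
same identity comes from uniqueness of bounded solutions of `r u - L u = g`
(`IsGreenMeasure.integral_eq_of_bounded`). For `g` supported in `[δ,M]` such a `u` is built by
variation of constants and equals `κ ψ` on `]0,δ]`, with `κ` independent of `x`. Uniqueness is a
minimum principle whose barrier is a Lyapunov function that explodes at both boundary points because
they are inaccessible.

If `0` is natural then `ψ(x) → 0` (`IsFundamental.tendsto_neg_q` with the bounds of
`exists_primitive`). If `F ≥ z r` on `]0,δ]`, then `R_F(x) - z = ∫ (F - z r) dG_x` is at least
`ψ(x)/ψ(δ)` times a constant, and this tends to `0`. That is the liminf bound; the limsup bound is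
the same statement for `-F`.

For (iii), take `b = 1 + x`, `σ = x`, `r = 1`, `u = 1/(1+x)` and `F = u - L u`. Uniqueness gives
`R_F = u → 1` at `0`, while `F/r → 2`. -/

namespace PosDiffusion

/-! ### Linear differential equations on an open interval -/

/-- A linear ordinary differential equation `y' = A y` with continuous coefficients on an open
interval has a solution on the whole interval, for every initial value. -/
theorem exists_hasDerivAt_linear {E : Type*} [NormedAddCommGroup E] [NormedSpace ℝ E]
    [CompleteSpace E] {s : Set ℝ} (hs : IsOpen s) (hc : s.OrdConnected)
    {A : ℝ → E →L[ℝ] E} (hA : ContinuousOn A s) {t₀ : ℝ} (ht₀ : t₀ ∈ s) (y₀ : E) :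
    ∃ y : ℝ → E, y t₀ = y₀ ∧ ∀ t ∈ s, HasDerivAt y (A t (y t)) t := by
  -- These are the increments of Picard iteration; the solution is the series `∑ y n`. The `n`-th
  -- term carries `1 / n!`, so the series converges on every compact interval without any smallness
  -- condition.
  let y : ℕ → ℝ → E := fun n => Nat.rec (fun _ => y₀) (fun _ f t => ∫ τ in t₀..t, A τ (f τ)) n
  have y0 : ∀ t, y 0 t = y₀ := fun t => rfl
  have ysucc : ∀ n t, y (n + 1) t = ∫ τ in t₀..t, A τ (y n τ) := fun n t => rfl
  have hderiv : ∀ n, ContinuousOn (y n) s →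
      ∀ t ∈ s, HasDerivAt (y (n + 1)) (A t (y n t)) t := by
    intro n hn t ht
    have hcont : ContinuousOn (fun τ => A τ (y n τ)) s := hA.clm_apply hn
    exact intervalIntegral.integral_hasDerivAt_right
      ((hcont.mono (hc.uIcc_subset ht₀ ht)).intervalIntegrable)
      (hcont.stronglyMeasurableAtFilter hs t ht) (hcont.continuousAt (hs.mem_nhds ht))
  have hycont : ∀ n, ContinuousOn (y n) s := by
    intro n
    induction n with
    | zero => exact continuousOn_const
    | succ n ih => exact fun t ht => (hderiv n ih t ht).continuousAt.continuousWithinAt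
  have hbound : ∀ a b : ℝ, t₀ ∈ Icc a b → Icc a b ⊆ s → ∀ C : ℝ, (∀ τ ∈ Icc a b, ‖A τ‖ ≤ C) →
      ∀ n, ∀ x ∈ Icc a b, ‖y n x‖ ≤ ‖y₀‖ * C ^ n * |x - t₀| ^ n / n.factorial := by
    intro a b hab hsub C hC n
    have hC0 : 0 ≤ C := (norm_nonneg _).trans (hC t₀ hab)
    induction n with
    | zero => intro x _; simp [y0]
    | succ n ih =>
      intro x hx
      have hsub' : Set.uIoc t₀ x ⊆ Icc a b :=
        uIoc_subset_uIcc.trans (ordConnected_Icc.uIcc_subset hab hx)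
      rw [ysucc]
      calc ‖∫ τ in t₀..x, A τ (y n τ)‖
          ≤ ∫ τ in Set.uIoc t₀ x, ‖A τ (y n τ)‖ := intervalIntegral.norm_integral_le_integral_norm_uIoc
        _ ≤ ∫ τ in Set.uIoc t₀ x, (‖y₀‖ * C ^ (n + 1) / n.factorial) * |τ - t₀| ^ n := by
            apply setIntegral_mono_on
            · have := ((hA.clm_apply (hycont n)).mono
                (hc.uIcc_subset ht₀ (hsub hx))).intervalIntegrable (μ := volume)
              exact (intervalIntegrable_iff.1 this).norm
            · have : Continuous fun τ => (‖y₀‖ * C ^ (n + 1) / n.factorial) * |τ - t₀| ^ n := by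
                fun_prop
              exact intervalIntegrable_iff.1 (this.intervalIntegrable _ _)
            · exact measurableSet_uIoc
            · intro τ hτ
              have h1 := hC τ (hsub' hτ)
              have h2 := ih τ (hsub' hτ)
              calc ‖A τ (y n τ)‖ ≤ ‖A τ‖ * ‖y n τ‖ := (A τ).le_opNorm _
                _ ≤ C * (‖y₀‖ * C ^ n * |τ - t₀| ^ n / n.factorial) := by gcongr
                _ = _ := by ring
        _ = _ := by
            rw [integral_const_mul, integral_pow_abs_sub_uIoc, Nat.factorial_succ]
            push_cast
            field_simp
  refine ⟨fun t => ∑' n, y n t, ?_, fun t ht => ?_⟩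
  · change ∑' n, y n t₀ = y₀
    refine (tsum_eq_single 0 fun n hn => ?_).trans (y0 t₀)
    obtain ⟨m, rfl⟩ := Nat.exists_eq_succ_of_ne_zero hn
    simp [ysucc]
  · obtain ⟨ε, hε, hεs⟩ := Metric.isOpen_iff.1 hs t ht
    obtain ⟨ε', hε', hεs'⟩ := Metric.isOpen_iff.1 hs t₀ ht₀
    set η := min ε ε' / 2 with hη
    have hη0 : 0 < η := by positivity
    have hη1 : η < ε := by have := min_le_left ε ε'; linarith
    have hη2 : η < ε' := by have := min_le_right ε ε'; linarith
    -- A compact interval inside `s` with both `t` and `t₀` in its interior: `A` is bounded there,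
    -- which makes the term-by-term differentiation uniform.
    set a := min t t₀ - η
    set b := max t t₀ + η
    have hmem : ∀ z, z = t ∨ z = t₀ → z - η ∈ s ∧ z + η ∈ s := by
      rintro z (rfl | rfl)
      · exact ⟨hεs (by simp [abs_of_pos hη0, hη1]), hεs (by simp [abs_of_pos hη0, hη1])⟩
      · exact ⟨hεs' (by simp [abs_of_pos hη0, hη2]), hεs' (by simp [abs_of_pos hη0, hη2])⟩
    have hsub : Icc a b ⊆ s := hc.out (hmem _ (min_choice t t₀)).1 (hmem _ (max_choice t t₀)).2
    have hta : t ∈ Ioo a b := ⟨by have := min_le_left t t₀; simp only [a]; linarith,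
      by have := le_max_left t t₀; simp only [b]; linarith⟩
    have ht₀a : t₀ ∈ Ioo a b := ⟨by have := min_le_right t t₀; simp only [a]; linarith,
      by have := le_max_right t t₀; simp only [b]; linarith⟩
    obtain ⟨C, hC⟩ := isCompact_Icc.exists_bound_of_continuousOn (hA.mono hsub)
    have hC0 : 0 ≤ C := (norm_nonneg _).trans (hC t (Ioo_subset_Icc_self hta))
    have hb := hbound a b (Ioo_subset_Icc_self ht₀a) hsub C hC
    have hb' : ∀ n, ∀ x ∈ Ioo a b, ‖y n x‖ ≤ ‖y₀‖ * ((C * (b - a)) ^ n / n.factorial) := by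
      intro n x hx
      refine (hb n x (Ioo_subset_Icc_self hx)).trans ?_
      rw [mul_pow, ← mul_div_assoc, ← mul_assoc]
      have : |x - t₀| ≤ b - a := by
        rw [abs_le]; constructor <;> linarith [hx.1, hx.2, ht₀a.1, ht₀a.2]
      gcongr
    have hsum : Summable fun n : ℕ => ‖y₀‖ * ((C * (b - a)) ^ n / n.factorial) :=
      (Real.summable_pow_div_factorial _).mul_left _
    -- The derivatives are shifted by one index: the constant term `y 0` contributes `0`, and `y (n
    -- + 1)` contributes `A (y n)`.
    let g' : ℕ → ℝ → E := fun n x => match n with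
      | 0 => 0
      | n + 1 => A x (y n x)
    let w : ℕ → ℝ := fun n => match n with
      | 0 => 0
      | n + 1 => C * (‖y₀‖ * ((C * (b - a)) ^ n / n.factorial))
    have hw : Summable w := (summable_nat_add_iff 1).1 (hsum.mul_left C)
    have hyt : Summable fun n => y n t := Summable.of_norm_bounded hsum (fun n => hb' n t hta)
    have key := hasDerivAt_tsum_of_isPreconnected (g := y) (g' := g') hw isOpen_Ioo
      isPreconnected_Ioo (y₀ := t) (y := t) ?_ ?_ hta hyt hta
    · convert! key using 1
      have hg : Summable fun n => g' n t := by
        rw [← summable_nat_add_iff 1]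
        exact hyt.map (A t) (A t).continuous
      rw [hg.tsum_eq_zero_add, (A t).map_tsum hyt]
      simp [g']
    · intro n x hx
      match n with
      | 0 => exact hasDerivAt_const x y₀
      | n + 1 => exact hderiv n (hycont n) x (hsub (Ioo_subset_Icc_self hx))
    · intro n x hx
      match n with
      | 0 => simp [g', w]
      | n + 1 =>
        exact ((A x).le_opNorm _).trans (mul_le_mul (hC x (Ioo_subset_Icc_self hx)) (hb' n x hx)
          (norm_nonneg _) hC0)

/-- The density `m'(x) = 2 / (σ²(x) p'(x))` of the speed measure. -/
noncomputable def speedDensity (b σ : ℝ → ℝ) (x : ℝ) : ℝ :=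
  2 / (σ x ^ 2 * scaleDeriv b σ x)

/-! ### Primitives and divergent integrals on the half-line -/

section Calculus

variable {g : ℝ → ℝ}

theorem uIcc_subset_Ioi_zero {a x : ℝ} (ha : 0 < a) (hx : 0 < x) : uIcc a x ⊆ Ioi 0 :=
  ordConnected_Ioi.uIcc_subset ha hx

theorem intervalIntegrable_of_continuousOn_Ioi (hg : ContinuousOn g (Ioi 0)) {a x : ℝ}
    (ha : 0 < a) (hx : 0 < x) : IntervalIntegrable g volume a x :=
  (hg.mono (uIcc_subset_Ioi_zero ha hx)).intervalIntegrable

theorem hasDerivAt_integral_of_continuousOn_Ioi (hg : ContinuousOn g (Ioi 0)) {a x : ℝ}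
    (ha : 0 < a) (hx : 0 < x) : HasDerivAt (fun y => ∫ s in a..y, g s) (g x) x :=
  intervalIntegral.integral_hasDerivAt_right (intervalIntegrable_of_continuousOn_Ioi hg ha hx)
    (hg.stronglyMeasurableAtFilter isOpen_Ioi x hx) (hg.continuousAt (Ioi_mem_nhds hx))

/-- The integral grows as its lower limit decreases, so failure to diverge would mean a uniform
bound; with `g ≥ 0` this would make `g` integrable up to `0`. -/
theorem tendsto_integral_zero_of_lintegral_eq_top (hg : ContinuousOn g (Ioi 0))
    (hg0 : ∀ x, 0 < x → x < 1 → 0 ≤ g x)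
    (htop : ∫⁻ y in Ioo (0 : ℝ) 1, ENNReal.ofReal (g y) = ⊤) :
    Tendsto (fun x => ∫ s in x..1, g s) (𝓝[>] 0) atTop := by
  have hmono : ∀ x y, 0 < x → x ≤ y → y < 1 → ∫ s in y..1, g s ≤ ∫ s in x..1, g s := by
    intro x y hx hxy hy
    rw [← intervalIntegral.integral_add_adjacent_intervals
      (intervalIntegrable_of_continuousOn_Ioi hg hx (hx.trans_le hxy))
      (intervalIntegrable_of_continuousOn_Ioi hg (hx.trans_le hxy) one_pos)]
    have : 0 ≤ ∫ s in x..y, g s := intervalIntegral.integral_nonneg hxy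
      fun s hs => hg0 s (hx.trans_le hs.1) (hs.2.trans_lt hy)
    linarith
  rw [tendsto_atTop]
  intro K
  by_contra hK
  have hle : ∀ x, 0 < x → x < 1 → ∫ s in x..1, g s ≤ K := by
    intro x hx hx1
    by_contra! hlt
    refine hK ?_
    filter_upwards [Ioo_mem_nhdsGT hx] with y hy
    exact hlt.le.trans (hmono y x hy.1 hy.2.le hx1)
  -- The shift by `2` keeps the sequence strictly below `1`, as `hle` requires.
  have hu : Tendsto (fun n : ℕ => 1 / ((n : ℝ) + 2)) atTop (𝓝 0) := by
    have := tendsto_one_div_add_atTop_nhds_zero_nat (𝕜 := ℝ)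
    refine ((tendsto_add_atTop_iff_nat 1).2 this).congr fun n => ?_
    push_cast; ring_nf
  have hint : IntegrableOn g (Ioc 0 1) := by
    refine integrableOn_Ioc_of_intervalIntegral_norm_bounded_left (I := K) (fun n : ℕ => ?_) hu
      (Eventually.of_forall fun n => ?_)
    · exact (intervalIntegrable_iff_integrableOn_Ioc_of_le (by
        rw [div_le_one (by positivity)]; have : (0 : ℝ) ≤ n := by positivity
        linarith)).1 (intervalIntegrable_of_continuousOn_Ioi hg (by positivity) one_pos)
    · have h0 : (0 : ℝ) < 1 / ((n : ℝ) + 2) := by positivity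
      have h1 : 1 / ((n : ℝ) + 2) < 1 := by
        rw [div_lt_one (by positivity)]; have : (0 : ℝ) ≤ n := by positivity
        linarith
      refine le_trans (le_of_eq ?_) (hle _ h0 h1)
      rw [intervalIntegral.integral_of_le h1.le, integral_Ioc_eq_integral_Ioo,
        integral_Ioc_eq_integral_Ioo]
      exact setIntegral_congr_fun measurableSet_Ioo fun s hs =>
        Real.norm_of_nonneg (hg0 s (h0.trans hs.1) hs.2)
  have := (hint.mono_set Ioo_subset_Ioc_self).lintegral_lt_top
  exact this.ne htop

theorem tendsto_integral_atTop_of_lintegral_eq_top (hg : ContinuousOn g (Ioi 0))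
    (hg0 : ∀ x, 1 < x → 0 ≤ g x)
    (htop : ∫⁻ y in Ioi (1 : ℝ), ENNReal.ofReal (g y) = ⊤) :
    Tendsto (fun x => ∫ s in (1 : ℝ)..x, g s) atTop atTop := by
  have hmono : ∀ x y, 1 < x → x ≤ y → ∫ s in (1 : ℝ)..x, g s ≤ ∫ s in (1 : ℝ)..y, g s := by
    intro x y hx hxy
    have hx0 : 0 < x := one_pos.trans hx
    rw [← intervalIntegral.integral_add_adjacent_intervals
      (intervalIntegrable_of_continuousOn_Ioi hg one_pos hx0)
      (intervalIntegrable_of_continuousOn_Ioi hg hx0 (hx0.trans_le hxy))]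
    have : 0 ≤ ∫ s in x..y, g s := intervalIntegral.integral_nonneg hxy
      fun s hs => hg0 s (hx.trans_le hs.1)
    linarith
  rw [tendsto_atTop]
  intro K
  by_contra hK
  have hle : ∀ x, 1 < x → ∫ s in (1 : ℝ)..x, g s ≤ K := by
    intro x hx
    by_contra! hlt
    refine hK ?_
    filter_upwards [eventually_ge_atTop x] with y hy
    exact hlt.le.trans (hmono x y hx hy)
  have hint : IntegrableOn g (Ioi 1) := by
    refine integrableOn_Ioi_of_intervalIntegral_norm_bounded (l := atTop) (b := fun x : ℝ => max x 2)
      K 1 (fun x => ?_)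
      (tendsto_atTop_mono (fun x => le_max_left x 2) tendsto_id) (Eventually.of_forall fun x => ?_)
    · have h2 : (2 : ℝ) ≤ max x 2 := le_max_right _ _
      exact (intervalIntegrable_iff_integrableOn_Ioc_of_le (by linarith)).1
        (intervalIntegrable_of_continuousOn_Ioi hg one_pos (by linarith))
    · have h2 : (2 : ℝ) ≤ max x 2 := le_max_right _ _
      have h1 : 1 < max x 2 := by linarith
      refine le_trans (le_of_eq ?_) (hle _ h1)
      rw [intervalIntegral.integral_of_le h1.le, intervalIntegral.integral_of_le h1.le]
      exact setIntegral_congr_fun measurableSet_Ioc fun s hs =>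
        Real.norm_of_nonneg (hg0 s hs.1)
  exact hint.lintegral_lt_top.ne htop

end Calculus

/-! ### Scale function, speed density and a Lyapunov function -/

section Coefficients

variable {b σ r : ℝ → ℝ}

theorem scaleDeriv_pos (x : ℝ) : 0 < scaleDeriv b σ x := Real.exp_pos _

namespace Admissible

variable (h : Admissible b σ r)
include h

theorem continuousOn_b : ContinuousOn b (Ioi 0) := h.b_lip.continuousOn.mono Ioi_subset_Ici_self

theorem continuousOn_σ : ContinuousOn σ (Ioi 0) := h.σ_lip.continuousOn.mono Ioi_subset_Ici_self

theorem continuousOn_r : ContinuousOn r (Ioi 0) := h.r_cont.mono Ioi_subset_Ici_self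

theorem hasDerivAt_scaleDeriv {x : ℝ} (hx : 0 < x) :
    HasDerivAt (scaleDeriv b σ) (-2 * (b x / σ x ^ 2) * scaleDeriv b σ x) x := by
  have hc : ContinuousOn (fun s => b s / σ s ^ 2) (Ioi 0) :=
    h.continuousOn_b.div (h.continuousOn_σ.pow 2) fun x hx => (pow_pos (h.σ_pos x hx) 2).ne'
  have := ((hasDerivAt_integral_of_continuousOn_Ioi hc one_pos hx).const_mul (-2)).exp
  convert! this using 1
  rw [scaleDeriv]; ring

theorem continuousOn_scaleDeriv : ContinuousOn (scaleDeriv b σ) (Ioi 0) :=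
  fun _ hx => (h.hasDerivAt_scaleDeriv hx).continuousAt.continuousWithinAt

theorem speedDensity_pos {x : ℝ} (hx : 0 < x) : 0 < speedDensity b σ x :=
  div_pos two_pos (mul_pos (pow_pos (h.σ_pos x hx) 2) (scaleDeriv_pos x))

theorem continuousOn_speedDensity : ContinuousOn (speedDensity b σ) (Ioi 0) :=
  continuousOn_const.div ((h.continuousOn_σ.pow 2).mul h.continuousOn_scaleDeriv)
    fun x hx => (mul_pos (pow_pos (h.σ_pos x hx) 2) (scaleDeriv_pos x)).ne'

/-- If `v' = p' q` then `½ σ² v'' + b v' = q' / m'`. -/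
theorem hasDerivAt_deriv {v q g : ℝ → ℝ}
    (hv : ∀ x, 0 < x → HasDerivAt v (scaleDeriv b σ x * q x) x)
    (hq : ∀ x, 0 < x → HasDerivAt q (g x * speedDensity b σ x) x) {x : ℝ} (hx : 0 < x) :
    HasDerivAt (deriv v) (2 / σ x ^ 2 * (g x - b x * (scaleDeriv b σ x * q x))) x := by
  have h1 := (h.hasDerivAt_scaleDeriv hx).mul (hq x hx)
  have h2 : deriv v =ᶠ[𝓝 x] scaleDeriv b σ * q := by
    filter_upwards [Ioi_mem_nhds hx] with y hy using (hv y hy).deriv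
  refine (h1.congr_of_eventuallyEq h2).congr_deriv ?_
  have := (h.σ_pos x hx).ne'
  have := (scaleDeriv_pos (b := b) (σ := σ) x).ne'
  rw [speedDensity]
  field_simp
  ring

theorem generator_eq {v q g : ℝ → ℝ}
    (hv : ∀ x, 0 < x → HasDerivAt v (scaleDeriv b σ x * q x) x)
    (hq : ∀ x, 0 < x → HasDerivAt q (g x * speedDensity b σ x) x) {x : ℝ} (hx : 0 < x) :
    generator b σ v x = g x := by
  rw [generator, (h.hasDerivAt_deriv hv hq hx).deriv, (hv x hx).deriv]
  have := (h.σ_pos x hx).ne'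
  field_simp
  ring

theorem contDiffOn_two {v q g : ℝ → ℝ} (hg : ContinuousOn g (Ioi 0))
    (hv : ∀ x, 0 < x → HasDerivAt v (scaleDeriv b σ x * q x) x)
    (hq : ∀ x, 0 < x → HasDerivAt q (g x * speedDensity b σ x) x) :
    ContDiffOn ℝ 2 v (Ioi 0) := by
  have hqc : ContinuousOn q (Ioi 0) := fun x hx => (hq x hx).continuousAt.continuousWithinAt
  have hd : ∀ x ∈ Ioi (0 : ℝ), _ := fun x hx => h.hasDerivAt_deriv hv hq hx
  rw [show (2 : WithTop ℕ∞) = 1 + 1 from (one_add_one_eq_two).symm,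
    contDiffOn_succ_iff_deriv_of_isOpen isOpen_Ioi]
  refine ⟨fun x hx => (hv x hx).differentiableAt.differentiableWithinAt, by simp, ?_⟩
  rw [show (1 : WithTop ℕ∞) = 0 + 1 from (zero_add 1).symm,
    contDiffOn_succ_iff_deriv_of_isOpen isOpen_Ioi]
  refine ⟨fun x hx => (hd x hx).differentiableAt.differentiableWithinAt, by simp, ?_⟩
  rw [contDiffOn_zero]
  refine ContinuousOn.congr ?_ fun x hx => (hd x hx).deriv
  exact (continuousOn_const.div (h.continuousOn_σ.pow 2)
    fun x hx => (pow_pos (h.σ_pos x hx) 2).ne').mul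
    (hg.sub (h.continuousOn_b.mul (h.continuousOn_scaleDeriv.mul hqc)))

theorem speedMeasure_Ioo {a c : ℝ} (ha : 0 < a) (hac : a ≤ c) :
    speedMeasure b σ (Ioo a c) = ENNReal.ofReal (∫ x in a..c, speedDensity b σ x) := by
  have hsub : Ioo a c ⊆ Ioi 0 := fun x hx => ha.trans hx.1
  rw [speedMeasure, withDensity_apply _ measurableSet_Ioo,
    Measure.restrict_restrict measurableSet_Ioo, inter_eq_self_of_subset_left hsub,
    intervalIntegral.integral_of_le hac, integral_Ioc_eq_integral_Ioo,
    ofReal_integral_eq_lintegral_ofReal]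
  · rfl
  · exact ((intervalIntegrable_iff_integrableOn_Ioc_of_le hac).1
      (intervalIntegrable_of_continuousOn_Ioi h.continuousOn_speedDensity ha
        (ha.trans_le hac))).mono_set Ioo_subset_Ioc_self
  · filter_upwards [ae_restrict_mem measurableSet_Ioo] with x hx
    exact (h.speedDensity_pos (hsub hx)).le

/-- A nonnegative `C²` function `V` with `L V ≤ r V` that explodes at both boundary points. -/
theorem exists_lyapunov : ∃ V : ℝ → ℝ, ContDiffOn ℝ 2 V (Ioi 0) ∧ (∀ x, 0 < x → 0 ≤ V x) ∧
    (∀ x, 0 < x → generator b σ V x ≤ r x * V x) ∧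
    Tendsto V (𝓝[>] 0) atTop ∧ Tendsto V atTop atTop := by
  obtain ⟨r₀, hr₀, hr⟩ := h.r_lower
  -- With `W' = p' n` and `n' = m'` one gets `L W = 1`, and the limits of `W` at the two ends are
  -- exactly the integrals of Feller's test. The constant `1/r₀` in `V = 1/r₀ + W` ensures `L V = 1
  -- ≤ r V`.
  set n : ℝ → ℝ := fun y => ∫ z in (1 : ℝ)..y, speedDensity b σ z with hn
  have hnd : ∀ x, 0 < x → HasDerivAt n (1 * speedDensity b σ x) x := fun x hx => by
    rw [one_mul]
    exact hasDerivAt_integral_of_continuousOn_Ioi h.continuousOn_speedDensity one_pos hx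
  have hnc : ContinuousOn n (Ioi 0) := fun x hx => (hnd x hx).continuousAt.continuousWithinAt
  have hpn : ContinuousOn (fun y => scaleDeriv b σ y * n y) (Ioi 0) :=
    h.continuousOn_scaleDeriv.mul hnc
  have hn1 : ∀ x, 1 ≤ x → 0 ≤ n x := fun x hx => intervalIntegral.integral_nonneg hx
    fun z hz => (h.speedDensity_pos (one_pos.trans_le hz.1)).le
  have hn2 : ∀ x, 0 < x → x ≤ 1 → n x ≤ 0 := fun x hx hx1 => by
    simp only [hn]
    rw [intervalIntegral.integral_symm]
    exact neg_nonpos.2 (intervalIntegral.integral_nonneg hx1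
      fun z hz => (h.speedDensity_pos (hx.trans_le hz.1)).le)
  set W : ℝ → ℝ := fun x => ∫ y in (1 : ℝ)..x, scaleDeriv b σ y * n y with hW
  have hW' : ∀ x, W x = ∫ y in x..1, -(scaleDeriv b σ y * n y) := fun x => by
    rw [intervalIntegral.integral_neg, ← intervalIntegral.integral_symm]
  have hW0 : ∀ x, 0 < x → 0 ≤ W x := by
    intro x hx
    rcases le_total 1 x with h1 | h1
    · exact intervalIntegral.integral_nonneg h1
        fun z hz => mul_nonneg (scaleDeriv_pos z).le (hn1 z hz.1)
    · rw [hW']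
      exact intervalIntegral.integral_nonneg h1 fun z hz => neg_nonneg.2
        (mul_nonpos_of_nonneg_of_nonpos (scaleDeriv_pos z).le (hn2 z (hx.trans_le hz.1) hz.2))
  have hVd : ∀ x, 0 < x → HasDerivAt (fun x => 1 / r₀ + W x) (scaleDeriv b σ x * n x) x :=
    fun x hx => (hasDerivAt_integral_of_continuousOn_Ioi hpn one_pos hx).const_add _
  refine ⟨fun x => 1 / r₀ + W x, h.contDiffOn_two continuousOn_const hVd hnd,
    fun x hx => add_nonneg (by positivity) (hW0 x hx), fun x hx => ?_, ?_, ?_⟩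
  · rw [h.generator_eq (g := fun _ => 1) hVd hnd hx]
    have h1 : 1 / r₀ ≤ 1 / r₀ + W x := le_add_of_nonneg_right (hW0 x hx)
    have h2 := hr x hx.le
    calc (1 : ℝ) = r₀ * (1 / r₀) := by field_simp
      _ ≤ r x * (1 / r₀ + W x) := by gcongr; linarith
  · refine tendsto_atTop_add_const_left _ _ ?_
    rw [show W = _ from funext hW']
    refine tendsto_integral_zero_of_lintegral_eq_top hpn.neg (fun x hx hx1 => neg_nonneg.2
        (mul_nonpos_of_nonneg_of_nonpos (scaleDeriv_pos x).le (hn2 x hx hx1.le))) ?_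
    rw [← h.zero_inaccessible]
    refine setLIntegral_congr_fun measurableSet_Ioo fun y hy => ?_
    rw [h.speedMeasure_Ioo hy.1 hy.2.le, ← ENNReal.ofReal_mul (scaleDeriv_pos y).le,
      intervalIntegral.integral_symm]
    congr 1
    simp only [hn]; ring
  · refine tendsto_atTop_add_const_left _ _ ?_
    refine tendsto_integral_atTop_of_lintegral_eq_top hpn (fun x hx =>
        (mul_nonneg (scaleDeriv_pos x).le (hn1 x hx.le))) ?_
    rw [← h.infty_inaccessible]
    refine setLIntegral_congr_fun measurableSet_Ioi fun y hy => ?_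
    rw [h.speedMeasure_Ioo one_pos (le_of_lt hy), ← ENNReal.ofReal_mul (scaleDeriv_pos y).le]

end Admissible

end Coefficients

/-! ### A smooth convex cut-off -/

section SmoothPosPart

/-- A smooth convex approximation of the positive part. -/
noncomputable def smoothPosPart (ε t : ℝ) : ℝ :=
  ∫ s in (0 : ℝ)..t, Real.smoothTransition ((s - ε) / ε)

variable {ε : ℝ}

theorem continuous_smoothPosPart_integrand (ε : ℝ) :
    Continuous fun s => Real.smoothTransition ((s - ε) / ε) :=
  Real.smoothTransition.continuous.comp (by fun_prop)

theorem hasDerivAt_smoothPosPart (ε t : ℝ) :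
    HasDerivAt (smoothPosPart ε) (Real.smoothTransition ((t - ε) / ε)) t :=
  (continuous_smoothPosPart_integrand ε).integral_hasStrictDerivAt 0 t |>.hasDerivAt

theorem contDiff_smoothPosPart (ε : ℝ) : ContDiff ℝ 2 (smoothPosPart ε) := by
  rw [show (2 : WithTop ℕ∞) = 1 + 1 from (one_add_one_eq_two).symm, contDiff_succ_iff_deriv]
  refine ⟨fun t => (hasDerivAt_smoothPosPart ε t).differentiableAt, by simp, ?_⟩
  rw [show deriv (smoothPosPart ε) = _ from funext fun t => (hasDerivAt_smoothPosPart ε t).deriv]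
  exact (Real.smoothTransition.contDiff (n := 1)).comp (by fun_prop)

theorem monotone_smoothPosPart_integrand (hε : 0 < ε) :
    Monotone fun s => Real.smoothTransition ((s - ε) / ε) :=
  Real.smoothTransition.monotone.comp fun s t hst => by gcongr

theorem smoothPosPart_eq_zero (hε : 0 < ε) {t : ℝ} (ht : t ≤ ε) : smoothPosPart ε t = 0 := by
  rw [smoothPosPart]
  have : ∀ s ∈ uIcc 0 t, Real.smoothTransition ((s - ε) / ε) = 0 := by
    intro s hs
    have hs' : s ≤ ε := hs.2.trans (max_le hε.le ht)
    exact Real.smoothTransition.zero_of_nonpos (div_nonpos_of_nonpos_of_nonneg (by linarith) hε.le)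
  rw [intervalIntegral.integral_congr this]
  simp

/-- The derivative is nondecreasing and the function vanishes at `0`. This is what lets the
zeroth-order term `r φ(u)` be absorbed into `φ'(u) r u` in the minimum principle. -/
theorem smoothPosPart_le (hε : 0 < ε) (t : ℝ) :
    smoothPosPart ε t ≤ t * Real.smoothTransition ((t - ε) / ε) := by
  rcases le_total t ε with ht | ht
  · rw [smoothPosPart_eq_zero hε ht, Real.smoothTransition.zero_of_nonpos
      (div_nonpos_of_nonpos_of_nonneg (by linarith) hε.le), mul_zero]
  · calc smoothPosPart ε t ≤ ∫ _ in (0 : ℝ)..t, Real.smoothTransition ((t - ε) / ε) :=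
        intervalIntegral.integral_mono_on (hε.le.trans ht)
          ((continuous_smoothPosPart_integrand ε).intervalIntegrable _ _)
          (continuous_const.intervalIntegrable _ _)
          fun s hs => monotone_smoothPosPart_integrand hε hs.2
      _ = _ := by simp

theorem sub_le_smoothPosPart (hε : 0 < ε) (t : ℝ) : t - 2 * ε ≤ smoothPosPart ε t := by
  rcases le_total t (2 * ε) with ht | ht
  · have : 0 ≤ smoothPosPart ε t := by
      rcases le_total t ε with h1 | h1
      · rw [smoothPosPart_eq_zero hε h1]
      · exact intervalIntegral.integral_nonneg (hε.le.trans h1)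
          fun s _ => Real.smoothTransition.nonneg _
    linarith
  · have hi := fun a b => (continuous_smoothPosPart_integrand ε).intervalIntegrable
      (μ := volume) a b
    rw [smoothPosPart, ← intervalIntegral.integral_add_adjacent_intervals (hi 0 (2 * ε)) (hi _ _)]
    have h1 : 0 ≤ ∫ s in (0 : ℝ)..(2 * ε), Real.smoothTransition ((s - ε) / ε) :=
      intervalIntegral.integral_nonneg (by positivity) fun s _ => Real.smoothTransition.nonneg _
    have h2 : ∫ s in (2 * ε)..t, Real.smoothTransition ((s - ε) / ε) = t - 2 * ε := by
      have : ∀ s ∈ uIcc (2 * ε) t, Real.smoothTransition ((s - ε) / ε) = 1 := by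
        intro s hs
        rw [uIcc_of_le ht] at hs
        refine Real.smoothTransition.one_of_one_le ?_
        rw [le_div_iff₀ hε]; linarith [hs.1]
      rw [intervalIntegral.integral_congr this]
      simp
    linarith

end SmoothPosPart

/-! ### Green measures, minimum principle and uniqueness -/

/-- The properties of the discounted occupation measure `G(A) = E_x[∫₀^∞ e^{-Λ_t} 1_A(X_t) dt]`
of the diffusion that determine it. -/
structure IsGreenMeasure (b σ r : ℝ → ℝ) (x : ℝ) (G : Measure ℝ) : Prop where
  finite : IsFiniteMeasure G
  pos : ∀ᵐ y ∂G, 0 < y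
  rate : ∫ y, r y ∂G = 1
  generator : ∀ f : ℝ → ℝ, ContDiff ℝ 2 f → HasCompactSupport f → tsupport f ⊆ Ioi 0 →
    ∫ y, (r y * f y - generator b σ f y) ∂G = f x

theorem hasDerivAt_of_contDiffOn_two {u : ℝ → ℝ} (hu : ContDiffOn ℝ 2 u (Ioi 0)) {y : ℝ}
    (hy : 0 < y) :
    HasDerivAt u (deriv u y) y ∧ HasDerivAt (deriv u) (deriv (deriv u) y) y := by
  have hu1 := hu
  rw [show (2 : WithTop ℕ∞) = 1 + 1 from (one_add_one_eq_two).symm,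
    contDiffOn_succ_iff_deriv_of_isOpen isOpen_Ioi] at hu1
  exact ⟨((hu1.1 y hy).differentiableAt (Ioi_mem_nhds hy)).hasDerivAt,
    ((hu1.2.2.differentiableOn one_ne_zero y hy).differentiableAt (Ioi_mem_nhds hy)).hasDerivAt⟩

namespace IsGreenMeasure

variable {b σ r : ℝ → ℝ} {x : ℝ} {G : Measure ℝ}

theorem integrable_of_bounded (hG : IsGreenMeasure b σ r x G) {g : ℝ → ℝ}
    (hg : ContinuousOn g (Ioi 0)) {N : ℝ} (hN : ∀ y, 0 < y → |g y| ≤ N) : Integrable g G := by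
  have := hG.finite
  have hr : G.restrict (Ioi 0) = G := Measure.restrict_eq_self_of_ae_mem hG.pos
  have hm : AEStronglyMeasurable g G := by
    rw [← hr]; exact hg.aestronglyMeasurable measurableSet_Ioi
  exact Integrable.of_bound hm N (by filter_upwards [hG.pos] with y hy using hN y hy)

/-- Minimum principle: a subsolution of `r u - L u ≤ g` that is eventually nonpositive near the
boundary is dominated by the Green potential of `g`. -/
theorem le_integral_of_subsolution (h : Admissible b σ r) (hG : IsGreenMeasure b σ r x G)
    (hx : 0 < x) {u g : ℝ → ℝ}
    (hu : ContDiffOn ℝ 2 u (Ioi 0)) (hg0 : ∀ y, 0 < y → 0 ≤ g y) (hgi : Integrable g G)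
    (hle : ∀ y, 0 < y → r y * u y - PosDiffusion.generator b σ u y ≤ g y)
    (hcpt : ∀ ε, 0 < ε → ∃ a c : ℝ, 0 < a ∧ ∀ y, 0 < y → ε ≤ u y → y ∈ Icc a c) :
    u x ≤ ∫ y, g y ∂G := by
  obtain ⟨r₀, hr₀, hr⟩ := h.r_lower
  suffices H : ∀ ε, 0 < ε → u x - 2 * ε ≤ ∫ y, g y ∂G by
    refine le_of_forall_pos_le_add fun ε hε => ?_
    have := H (ε / 2) (by positivity)
    linarith
  -- For the smooth convex cut-off `φ` at level `ε`, the function `φ(u)` has compact support in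
  -- `]0,∞[` and is an admissible test function. The cut-off loses at most `2 ε`.
  intro ε hε
  obtain ⟨a, c, ha, hac⟩ := hcpt ε hε
  set f : ℝ → ℝ := fun y => if 0 < y then smoothPosPart ε (u y) else 0 with hf
  have hfu : ∀ y, 0 < y → f =ᶠ[𝓝 y] smoothPosPart ε ∘ u := fun y hy => by
    filter_upwards [Ioi_mem_nhds hy] with z hz
    simp only [hf]
    rw [if_pos (show 0 < z from hz)]; rfl
  have hsupp : Function.support f ⊆ Icc a c := by
    intro y hy
    by_contra hyn
    refine hy ?_
    simp only [hf]
    split_ifs with hy0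
    · refine smoothPosPart_eq_zero hε ?_
      by_contra! hlt
      exact hyn (hac y hy0 hlt.le)
    · rfl
  have htsupp : tsupport f ⊆ Icc a c := closure_minimal hsupp isClosed_Icc
  have hfc : ContDiff ℝ 2 f := by
    rw [contDiff_iff_contDiffAt]
    intro y
    by_cases hy : 0 < y
    · exact (((contDiff_smoothPosPart ε).contDiffAt).comp y
        (hu.contDiffAt (Ioi_mem_nhds hy))).congr_of_eventuallyEq (hfu y hy)
    · refine contDiffAt_const (c := (0 : ℝ)) |>.congr_of_eventuallyEq ?_
      filter_upwards [Iio_mem_nhds (show y < a by linarith)] with z hz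
      by_contra hne
      exact absurd (hsupp hne).1 (not_le.2 hz)
  have key := hG.generator f hfc (HasCompactSupport.of_support_subset_isCompact isCompact_Icc hsupp)
    (htsupp.trans fun y hy => ha.trans_le hy.1)
  -- By the chain rule `L φ(u) = φ'(u) L u + ½ σ² φ''(u) u'²`. Convexity gives the last term a sign,
  -- so `r φ(u) - L φ(u) ≤ φ'(u) (r u - L u) ≤ φ'(u) g ≤ g`.
  have hAf : ∀ y, 0 < y → r y * f y - PosDiffusion.generator b σ f y ≤ g y := by
    intro y hy
    set S := fun t => Real.smoothTransition ((t - ε) / ε) with hS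
    have hd1 : ∀ z, 0 < z → HasDerivAt f (S (u z) * deriv u z) z := fun z hz =>
      ((hasDerivAt_smoothPosPart ε (u z)).comp z
        (hasDerivAt_of_contDiffOn_two hu hz).1).congr_of_eventuallyEq (hfu z hz)
    have hS1 : HasDerivAt S (deriv S (u y)) (u y) := by
      have : ContDiff ℝ 1 S := (Real.smoothTransition.contDiff (n := 1)).comp (by fun_prop)
      exact (this.differentiable one_ne_zero _).hasDerivAt
    have hS0 : 0 ≤ deriv S (u y) := (monotone_smoothPosPart_integrand hε).deriv_nonneg
    have hd2 : HasDerivAt (deriv f) (deriv S (u y) * deriv u y * deriv u y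
        + S (u y) * deriv (deriv u) y) y := by
      refine ((hS1.comp y (hasDerivAt_of_contDiffOn_two hu hy).1).mul
        (hasDerivAt_of_contDiffOn_two hu hy).2).congr_of_eventuallyEq ?_
      filter_upwards [Ioi_mem_nhds hy] with z hz using (hd1 z hz).deriv
    have hfy : f y = smoothPosPart ε (u y) := if_pos hy
    have h1 : r y * f y ≤ r y * (u y * S (u y)) := by
      rw [hfy]
      exact mul_le_mul_of_nonneg_left (smoothPosPart_le hε _) (hr₀.le.trans (hr y hy.le))
    have h2 : S (u y) * (r y * u y - PosDiffusion.generator b σ u y) ≤ S (u y) * g y :=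
      mul_le_mul_of_nonneg_left (hle y hy) (Real.smoothTransition.nonneg _)
    have h3 : S (u y) * g y ≤ g y :=
      mul_le_of_le_one_left (hg0 y hy) (Real.smoothTransition.le_one _)
    have h4 : 0 ≤ (1 / 2) * σ y ^ 2 * (deriv S (u y) * deriv u y * deriv u y) := by
      rw [mul_assoc (deriv S (u y))]
      have := mul_self_nonneg (deriv u y)
      positivity
    have h5 : PosDiffusion.generator b σ f y
        = S (u y) * PosDiffusion.generator b σ u y
          + (1 / 2) * σ y ^ 2 * (deriv S (u y) * deriv u y * deriv u y) := by
      rw [PosDiffusion.generator, PosDiffusion.generator, hd2.deriv, (hd1 y hy).deriv]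
      ring
    rw [h5]
    nlinarith
  have hfx : f x = smoothPosPart ε (u x) := if_pos hx
  refine (sub_le_smoothPosPart hε (u x)).trans ?_
  rw [← hfx, ← key]
  -- If the left integrand is not integrable, its integral is `0` by convention, and `g ≥ 0` still
  -- gives the inequality.
  by_cases hi : Integrable (fun y => r y * f y - PosDiffusion.generator b σ f y) G
  · exact integral_mono_ae hi hgi (by filter_upwards [hG.pos] with y hy using hAf y hy)
  · rw [integral_undef hi]
    exact integral_nonneg_of_ae (by filter_upwards [hG.pos] with y hy using hg0 y hy)

/-- The minimum principle is applied to `u + K - η V`, with `V` the Lyapunov function. The term `-η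
V` pushes the function below zero near both boundary points at no cost, because `L V ≤ r V`. The
choice `K = N/r₀` makes the right-hand side `g + K r` nonnegative, and `∫ K r dG = K` cancels it
again. Then `η ↓ 0`. -/
theorem le_integral_of_bounded (h : Admissible b σ r) (hG : IsGreenMeasure b σ r x G)
    (hx : 0 < x) {u g : ℝ → ℝ} {M N : ℝ}
    (hu : ContDiffOn ℝ 2 u (Ioi 0)) (hM : ∀ y, 0 < y → |u y| ≤ M)
    (hg : ContinuousOn g (Ioi 0)) (hN : ∀ y, 0 < y → |g y| ≤ N)
    (heq : ∀ y, 0 < y → r y * u y - PosDiffusion.generator b σ u y = g y) :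
    u x ≤ ∫ y, g y ∂G := by
  have := hG.finite
  obtain ⟨r₀, hr₀, hr⟩ := h.r_lower
  obtain ⟨r₁, hr₁⟩ := h.r_upper
  obtain ⟨V, hV, hV0, hVL, hVz, hVi⟩ := h.exists_lyapunov
  have hN0 : 0 ≤ N := (abs_nonneg _).trans (hN x hx)
  set K := N / r₀ with hK
  have hK0 : 0 ≤ K := by positivity
  have hgi := hG.integrable_of_bounded hg hN
  have hri : Integrable r G := hG.integrable_of_bounded h.continuousOn_r (N := r₁) fun y hy => by
    rw [abs_of_nonneg (hr₀.le.trans (hr y hy.le))]; exact hr₁ y hy.le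
  have H : ∀ η, 0 < η → u x + K - η * V x ≤ ∫ y, (g y + K * r y) ∂G := by
    intro η hη
    refine le_integral_of_subsolution h hG hx (u := fun y => u y + K - η * V y)
      ((hu.add contDiffOn_const).sub (contDiffOn_const.mul hV)) (fun y hy => ?_)
      (hgi.add (hri.const_mul K)) (fun y hy => ?_) (fun ε hε => ?_)
    · have h1 : N ≤ K * r y := by
        calc N = N / r₀ * r₀ := by field_simp
          _ ≤ K * r y := by gcongr; exact hr y hy.le
      have := neg_le_of_abs_le (hN y hy)
      linarith
    · have hd : ∀ z, 0 < z → HasDerivAt (fun y => u y + K - η * V y)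
          (deriv u z - η * deriv V z) z := fun z hz =>
        ((hasDerivAt_of_contDiffOn_two hu hz).1.add_const K).sub
          ((hasDerivAt_of_contDiffOn_two hV hz).1.const_mul η)
      have hd2 : HasDerivAt (deriv fun y => u y + K - η * V y)
          (deriv (deriv u) y - η * deriv (deriv V) y) y := by
        refine ((hasDerivAt_of_contDiffOn_two hu hy).2.sub
          ((hasDerivAt_of_contDiffOn_two hV hy).2.const_mul η)).congr_of_eventuallyEq ?_
        filter_upwards [Ioi_mem_nhds hy] with z hz using (hd z hz).deriv
      have h1 := heq y hy
      have h2 := mul_le_mul_of_nonneg_left (hVL y hy) hη.le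
      simp only [PosDiffusion.generator, hd2.deriv, (hd y hy).deriv] at h1 h2 ⊢
      linear_combination h1 + h2
    · obtain ⟨a, ha, haV⟩ := mem_nhdsGT_iff_exists_Ioo_subset.1
        (hVz.eventually (eventually_gt_atTop ((M + K) / η)))
      obtain ⟨c, hc⟩ := eventually_atTop.1 (hVi.eventually (eventually_gt_atTop ((M + K) / η)))
      refine ⟨a, c, ha, fun y hy hεy => ?_⟩
      have hle : ¬ (M + K) / η < V y := by
        rw [div_lt_iff₀ hη]
        have := le_of_abs_le (hM y hy)
        linarith
      constructor
      · by_contra! hlt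
        exact hle (haV ⟨hy, hlt⟩)
      · by_contra! hlt
        exact hle (hc y hlt.le)
  rw [integral_add hgi (hri.const_mul K), integral_const_mul, hG.rate, mul_one] at H
  have hlim : Tendsto (fun η : ℝ => u x + K - η * V x) (𝓝[>] 0) (𝓝 (u x + K - 0 * V x)) := by
    refine Tendsto.mono_left ?_ nhdsWithin_le_nhds
    exact (by fun_prop : Continuous fun η : ℝ => u x + K - η * V x).tendsto 0
  have := le_of_tendsto hlim (by filter_upwards [self_mem_nhdsWithin] with η hη using H η hη)
  linarith

/-- A bounded solution of `r u - L u = g` is the Green potential of `g`. -/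
theorem integral_eq_of_bounded (h : Admissible b σ r) (hG : IsGreenMeasure b σ r x G)
    (hx : 0 < x) {u g : ℝ → ℝ} {M N : ℝ}
    (hu : ContDiffOn ℝ 2 u (Ioi 0)) (hM : ∀ y, 0 < y → |u y| ≤ M)
    (hg : ContinuousOn g (Ioi 0)) (hN : ∀ y, 0 < y → |g y| ≤ N)
    (heq : ∀ y, 0 < y → r y * u y - PosDiffusion.generator b σ u y = g y) :
    ∫ y, g y ∂G = u x := by
  refine le_antisymm ?_ (hG.le_integral_of_bounded h hx hu hM hg hN heq)
  have := hG.le_integral_of_bounded h hx (u := -u) (g := -g) (M := M) (N := N) hu.neg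
    (by simpa using hM) hg.neg (by simpa using hN) (fun y hy => by
      have h1 : PosDiffusion.generator b σ (-u) y = -PosDiffusion.generator b σ u y := by
        simp only [PosDiffusion.generator, deriv.neg']
        rw [show (deriv fun y => -deriv u y) = fun y => -deriv (deriv u) y from
          funext fun z => deriv.fun_neg]
        ring
      simp only [h1, Pi.neg_apply, ← heq y hy]
      ring)
  simp only [Pi.neg_apply, integral_neg] at this
  linarith

end IsGreenMeasure

/-! ### Discounting along a single path -/

section Paths

theorem hasDerivAt_exp_neg_integral {ρ : ℝ → ℝ} (hρ : Continuous ρ) (s : ℝ) :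
    HasDerivAt (fun s => Real.exp (-∫ z in (0 : ℝ)..s, ρ z))
      (-(ρ s * Real.exp (-∫ z in (0 : ℝ)..s, ρ z))) s := by
  refine ((hρ.integral_hasStrictDerivAt 0 s).hasDerivAt.fun_neg.exp).congr_deriv ?_
  ring

theorem continuous_exp_neg_integral {ρ : ℝ → ℝ} (hρ : Continuous ρ) :
    Continuous fun s => Real.exp (-∫ z in (0 : ℝ)..s, ρ z) :=
  continuous_iff_continuousAt.2 fun s => (hasDerivAt_exp_neg_integral hρ s).continuousAt

/-- Integration by parts for the product of `φ - φ(0) - ∫ g` and the discount factor. -/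
theorem sub_integral_mul_discount {ρ φ g : ℝ → ℝ} (hρ : Continuous ρ) (hφ : Continuous φ)
    (hg : Continuous g) (t c : ℝ) (hc : c = φ t - φ 0 - ∫ z in (0 : ℝ)..t, g z) :
    c - ∫ s in (0 : ℝ)..t, (c - (φ s - φ 0 - ∫ z in (0 : ℝ)..s, g z))
        * (ρ s * Real.exp (-∫ z in (0 : ℝ)..s, ρ z))
      = φ t * Real.exp (-∫ z in (0 : ℝ)..t, ρ z) - φ 0
        + ∫ s in (0 : ℝ)..t, Real.exp (-∫ z in (0 : ℝ)..s, ρ z) * (ρ s * φ s - g s) := by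
  have hD := hasDerivAt_exp_neg_integral hρ
  have hDc := continuous_exp_neg_integral hρ
  have hB : ∀ s, HasDerivAt (fun s => ∫ z in (0 : ℝ)..s, g z) (g s) s := fun s =>
    (hg.integral_hasStrictDerivAt 0 s).hasDerivAt
  have hBc : Continuous fun s => ∫ z in (0 : ℝ)..s, g z :=
    continuous_iff_continuousAt.2 fun s => (hB s).continuousAt
  set D := fun s => Real.exp (-∫ z in (0 : ℝ)..s, ρ z) with hDdef
  set B := fun s => ∫ z in (0 : ℝ)..s, g z with hBdef
  have h1 : Continuous fun s => (c - (φ s - φ 0 - B s)) * (ρ s * D s) := by fun_prop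
  have h2 : Continuous fun s => D s * (ρ s * φ s - g s) := by fun_prop
  -- The path `φ` need not be differentiable, but the two terms containing `φ` in the sum of the
  -- integrands cancel; the remainder has an explicit primitive.
  have hE : ∀ s ∈ uIcc 0 t, HasDerivAt (fun s => -(D s * (c + φ 0 + B s)))
      ((c - (φ s - φ 0 - B s)) * (ρ s * D s) + D s * (ρ s * φ s - g s)) s := fun s _ => by
    refine ((hD s).mul ((hB s).const_add (c + φ 0))).neg.congr_deriv ?_
    simp only [hDdef, hBdef]
    ring
  have key := intervalIntegral.integral_eq_sub_of_hasDerivAt hE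
    ((h1.add h2).intervalIntegrable _ _)
  rw [intervalIntegral.integral_add (h1.intervalIntegrable _ _) (h2.intervalIntegrable _ _)] at key
  have hD0 : D 0 = 1 := by simp [hDdef]
  have hB0 : B 0 = 0 := by simp [hBdef]
  rw [hD0, hB0] at key
  change c - ∫ s in (0 : ℝ)..t, (c - (φ s - φ 0 - B s)) * (ρ s * D s)
    = φ t * D t - φ 0 + ∫ s in (0 : ℝ)..t, D s * (ρ s * φ s - g s)
  have hct : φ t = c + φ 0 + B t := by rw [hc]; simp only [hBdef]; ring
  rw [hct]
  linarith

theorem exp_neg_integral_le {ρ : ℝ → ℝ} (hρ : Continuous ρ) {r₀ : ℝ} (hr : ∀ s, r₀ ≤ ρ s) {t : ℝ}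
    (ht : 0 ≤ t) : Real.exp (-∫ z in (0 : ℝ)..t, ρ z) ≤ Real.exp (-r₀ * t) := by
  rw [Real.exp_le_exp]
  have : ∫ _ in (0 : ℝ)..t, r₀ ≤ ∫ z in (0 : ℝ)..t, ρ z :=
    intervalIntegral.integral_mono_on ht (by simp) (hρ.intervalIntegrable _ _) fun s _ => hr s
  rw [intervalIntegral.integral_const] at this
  simp only [sub_zero, smul_eq_mul] at this
  linarith

theorem integrableOn_discount {ρ : ℝ → ℝ} (hρ : Continuous ρ) {r₀ : ℝ} (hr₀ : 0 < r₀)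
    (hr : ∀ s, r₀ ≤ ρ s) {g : ℝ → ℝ} (hg : Continuous g) {C : ℝ} (hC : ∀ s, |g s| ≤ C) :
    IntegrableOn (fun s => Real.exp (-∫ z in (0 : ℝ)..s, ρ z) * g s) (Ioi 0) := by
  refine Integrable.mono' ((integrableOn_exp_mul_Ioi (neg_neg_of_pos hr₀) 0).mul_const C)
    (((continuous_exp_neg_integral hρ).mul hg).aestronglyMeasurable) ?_
  filter_upwards [ae_restrict_mem measurableSet_Ioi] with s hs
  rw [norm_mul, Real.norm_of_nonneg (Real.exp_pos _).le]
  exact mul_le_mul (exp_neg_integral_le hρ hr (le_of_lt hs)) (hC s) (abs_nonneg _)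
    (Real.exp_pos _).le

theorem integral_rate_mul_discount {ρ : ℝ → ℝ} (hρ : Continuous ρ) {r₀ : ℝ} (hr₀ : 0 < r₀)
    (hr : ∀ s, r₀ ≤ ρ s) {C : ℝ} (hC : ∀ s, |ρ s| ≤ C) :
    ∫ s in Ioi (0 : ℝ), Real.exp (-∫ z in (0 : ℝ)..s, ρ z) * ρ s = 1 := by
  have := integral_Ioi_of_hasDerivAt_of_tendsto' (a := (0 : ℝ)) (m := 0)
    (f := fun s => -Real.exp (-∫ z in (0 : ℝ)..s, ρ z))
    (f' := fun s => Real.exp (-∫ z in (0 : ℝ)..s, ρ z) * ρ s)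
    (fun s _ => (hasDerivAt_exp_neg_integral hρ s).neg.congr_deriv (by ring))
    (integrableOn_discount hρ hr₀ hr hρ hC) (by
      suffices H : Tendsto (fun s => Real.exp (-∫ z in (0 : ℝ)..s, ρ z)) atTop (𝓝 0) by
        simpa using H.neg
      refine squeeze_zero' (Eventually.of_forall fun s => (Real.exp_pos _).le)
        (eventually_ge_atTop 0 |>.mono fun s hs => exp_neg_integral_le hρ hr hs) ?_
      exact Real.tendsto_exp_atBot.comp
        (tendsto_id.const_mul_atTop_of_neg (neg_neg_of_pos hr₀)))
  simpa using this

end Paths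

/-! ### Measurability of path functionals -/

section Measurability

variable {α : Type*} {m : MeasurableSpace α}

theorem measurable_comp_of_pos {F : ℝ → ℝ} (hF : Measurable fun x : Ioi (0 : ℝ) => F x)
    {u : α → ℝ} (hu : Measurable u) (hpos : ∀ a, 0 < u a) : Measurable fun a => F (u a) :=
  hF.comp (hu.subtype_mk (h := hpos))

theorem measurable_of_continuousOn_Ioi {g : ℝ → ℝ} (hg : ContinuousOn g (Ioi 0)) :
    Measurable fun x : Ioi (0 : ℝ) => g x :=
  (continuousOn_iff_continuous_domRestrict.1 hg).measurable

theorem measurable_integral_of_continuous {Z : ℝ → α → ℝ}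
    (hc : ∀ a, Continuous fun s => Z s a) (hm : ∀ s, Measurable (Z s)) (t : ℝ) :
    Measurable fun a => ∫ s in (0 : ℝ)..t, Z s a := by
  have hZ : StronglyMeasurable (Function.uncurry Z) :=
    (measurable_uncurry_of_continuous_of_measurable hc hm).stronglyMeasurable
  simp only [intervalIntegral]
  exact (hZ.integral_prod_left.sub hZ.integral_prod_left).measurable

end Measurability

/-! ### Martingale increments against adapted weights -/

section Martingale

variable {Ω : Type*} {mΩ : MeasurableSpace Ω} {P : Measure Ω} [IsProbabilityMeasure P]
  {𝓕 : Filtration ℝ≥0 mΩ}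

theorem integral_martingale_sub_mul {M : ℝ≥0 → Ω → ℝ} (hM : Martingale M 𝓕 P) {s t : ℝ≥0}
    (hst : s ≤ t) {Z : Ω → ℝ} (hZ : Measurable[𝓕 s] Z) {c : ℝ} (hc : ∀ ω, |Z ω| ≤ c) :
    ∫ ω, (M t ω - M s ω) * Z ω ∂P = 0 := by
  have hint : Integrable (M t - M s) P := (hM.integrable t).sub (hM.integrable s)
  have hZs : StronglyMeasurable[𝓕 s] Z := hZ.stronglyMeasurable
  have h1 := condExp_stronglyMeasurable_mul_of_bound (𝓕.le s) hZs hint c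
    (Eventually.of_forall hc)
  have h2 : P[M t - M s | 𝓕 s] =ᵐ[P] 0 := by
    filter_upwards [condExp_sub (hM.integrable t) (hM.integrable s) (𝓕 s),
      hM.condExp_ae_eq hst, hM.condExp_ae_eq (le_refl s)] with ω e1 e2 e3
    simp [e1, e2, e3]
  calc ∫ ω, (M t ω - M s ω) * Z ω ∂P = ∫ ω, (Z * (M t - M s)) ω ∂P := by
        refine integral_congr_ae (Eventually.of_forall fun ω => ?_)
        simp [mul_comm]
    _ = ∫ ω, (P[Z * (M t - M s) | 𝓕 s]) ω ∂P := (integral_condExp (𝓕.le s)).symm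
    _ = ∫ _, (0 : ℝ) ∂P := by
        refine integral_congr_ae ?_
        filter_upwards [h1, h2] with ω e1 e2
        simp [e1, e2]
    _ = 0 := by simp

/-- Increments of `M` after time `s` are orthogonal to bounded `𝓕 s`-measurable variables; Fubini
integrates this over `s`. For `Z = r(X) D` with `D = e^{-Λ}`, one has `∫₀ᵗ Z = 1 - D_t`, so the
integrand is `M_t D_t - ∫ M dD`, that is, `∫ D dM`. This replaces stochastic integration. -/
theorem integral_martingale_integral_mul {M Z : ℝ≥0 → Ω → ℝ} (hM : Martingale M 𝓕 P)
    (hMc : ∀ ω, Continuous fun t => M t ω) (hM0 : ∀ ω, M 0 ω = 0)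
    (hZ : ∀ s, Measurable[𝓕 s] (Z s)) (hZc : ∀ ω, Continuous fun t => Z t ω) {c : ℝ}
    (hc : ∀ s ω, |Z s ω| ≤ c) (t : ℝ≥0) {C : ℝ} (hC : ∀ s ≤ t, ∀ ω, |M s ω| ≤ C) :
    ∫ ω, (M t ω - ∫ s in (0 : ℝ)..t, (M t ω - M s.toNNReal ω) * Z s.toNNReal ω) ∂P = 0 := by
  have hMm : ∀ s, Measurable (M s) := fun s => ((hM.stronglyAdapted s).mono (𝓕.le s)).measurable
  have hmeas : Measurable (Function.uncurry fun (s : ℝ) ω =>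
      (M t ω - M s.toNNReal ω) * Z s.toNNReal ω) := by
    refine measurable_uncurry_of_continuous_of_measurable (fun ω => ?_) (fun s => ?_)
    · exact (continuous_const.sub ((hMc ω).comp continuous_real_toNNReal)).mul
        ((hZc ω).comp continuous_real_toNNReal)
    · exact ((hMm t).sub (hMm _)).mul ((hZ _).mono (𝓕.le _) le_rfl)
  have hbound : ∀ s ∈ Ioc (0 : ℝ) t, ∀ ω,
      ‖(M t ω - M s.toNNReal ω) * Z s.toNNReal ω‖ ≤ (C + C) * c := by
    intro s hs ω
    have hst : s.toNNReal ≤ t := by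
      rw [Real.toNNReal_le_iff_le_coe]; exact hs.2
    rw [norm_mul]
    exact mul_le_mul ((norm_sub_le _ _).trans (add_le_add (hC t le_rfl ω) (hC _ hst ω)))
      (hc _ ω) (abs_nonneg _) (add_nonneg ((abs_nonneg _).trans (hC t le_rfl ω))
        ((abs_nonneg _).trans (hC t le_rfl ω)))
  have hint : Integrable (Function.uncurry fun (s : ℝ) ω =>
      (M t ω - M s.toNNReal ω) * Z s.toNNReal ω) ((volume.restrict (Ioc (0 : ℝ) t)).prod P) := by
    refine Integrable.of_bound hmeas.aestronglyMeasurable ((C + C) * c) ?_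
    have hset : MeasurableSet {z : ℝ × Ω | z.1 ∈ Ioc (0 : ℝ) t} :=
      measurable_fst measurableSet_Ioc
    have : ∀ᵐ z ∂((volume.restrict (Ioc (0 : ℝ) t)).prod P), z.1 ∈ Ioc (0 : ℝ) (t : ℝ) :=
      Measure.quasiMeasurePreserving_fst.ae (ae_restrict_mem measurableSet_Ioc)
    filter_upwards [this] with z hz using hbound z.1 hz z.2
  simp only [intervalIntegral.integral_of_le (NNReal.coe_nonneg t)]
  have hint' : Integrable (fun ω => ∫ s in Ioc (0 : ℝ) t,
      (M t ω - M s.toNNReal ω) * Z s.toNNReal ω) P := hint.integral_prod_right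
  rw [integral_sub (hM.integrable t) hint']
  have e1 : ∫ ω, M t ω ∂P = 0 := by
    have := integral_martingale_sub_mul hM (s := 0) (t := t) zero_le (Z := fun _ => 1) measurable_const
      (c := 1) (by simp)
    simpa [hM0] using this
  have e2 : ∫ ω, (∫ s in Ioc (0 : ℝ) t, (M t ω - M s.toNNReal ω) * Z s.toNNReal ω) ∂P = 0 := by
    rw [← integral_integral_swap hint]
    rw [setIntegral_congr_fun (g := fun _ => (0 : ℝ)) measurableSet_Ioc]
    · simp
    · intro s hs
      have hst : s.toNNReal ≤ t := by
        rw [Real.toNNReal_le_iff_le_coe]; exact hs.2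
      exact integral_martingale_sub_mul hM hst (hZ _) (hc _)
  rw [e1, e2, sub_zero]

end Martingale

/-! ### The occupation measure of a diffusion is a Green measure -/

/-- The discounted occupation measure `G(A) = E[∫₀^∞ e^{-Λ_t} 1_A(X_t) dt]`. -/
noncomputable def greenMeasure {Ω : Type*} [MeasurableSpace Ω] (r : ℝ → ℝ) (P : Measure Ω)
    (X : ℝ≥0 → Ω → ℝ) : Measure ℝ :=
  ((P.prod (volume.restrict (Ioi (0 : ℝ)))).withDensity
    fun z => ENNReal.ofReal (Real.exp (-discount r X z.2 z.1))).map fun z => X z.2.toNNReal z.1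

theorem measurable_indicator_Ioi {F : ℝ → ℝ} (hF : Measurable fun x : Ioi (0 : ℝ) => F x) :
    Measurable ((Ioi (0 : ℝ)).indicator F) := by
  refine measurable_of_restrict_of_restrict_compl (s := Ioi (0 : ℝ)) measurableSet_Ioi ?_ ?_
  · convert! hF using 1
    ext x
    exact indicator_of_mem x.2 F
  · convert! (measurable_const : Measurable fun _ : ((Ioi (0 : ℝ))ᶜ : Set ℝ) => (0 : ℝ)) using 1
    ext x
    exact indicator_of_notMem x.2 F

/-- The generator of a `C²` function with compact support in `]0,∞[` is bounded. -/
theorem exists_bound_generator {b σ r : ℝ → ℝ} (h : Admissible b σ r) {f : ℝ → ℝ}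
    (hf : ContDiff ℝ 2 f) (hfc : HasCompactSupport f) (hfs : tsupport f ⊆ Ioi 0) :
    ContinuousOn (generator b σ f) (Ioi 0) ∧ ∃ C, ∀ y, |generator b σ f y| ≤ C := by
  have hd2 : ContDiff ℝ 1 (deriv f) := by
    rw [show (2 : WithTop ℕ∞) = 1 + 1 from (one_add_one_eq_two).symm, contDiff_succ_iff_deriv] at hf
    exact hf.2.2
  have hc : ContinuousOn (generator b σ f) (Ioi 0) :=
    ((continuousOn_const.mul (h.continuousOn_σ.pow 2)).mul
      (hd2.continuous_deriv le_rfl).continuousOn).add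
      (h.continuousOn_b.mul hd2.continuous.continuousOn)
  obtain ⟨C, hC⟩ := hfc.isCompact.exists_bound_of_continuousOn (hc.mono hfs)
  refine ⟨hc, max C 0, fun y => ?_⟩
  by_cases hy : y ∈ tsupport f
  · exact (hC y hy).trans (le_max_left _ _)
  · have h1 : y ∉ tsupport (deriv f) := fun h' => hy (tsupport_deriv_subset h')
    have h2 : y ∉ tsupport (deriv (deriv f)) := fun h' => h1 (tsupport_deriv_subset h')
    simp [generator, image_eq_zero_of_notMem_tsupport h1, image_eq_zero_of_notMem_tsupport h2]

namespace IsDiffusion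

variable {Ω : Type*} {mΩ : MeasurableSpace Ω} {b σ r : ℝ → ℝ} {x : ℝ}
  {𝓕 : Filtration ℝ≥0 mΩ} {P : Measure Ω} {X : ℝ≥0 → Ω → ℝ}

section

variable (hX : IsDiffusion b σ x 𝓕 P X)
include hX

theorem measurable_apply (t : ℝ≥0) : Measurable[𝓕 t] (X t) := (hX.adapted t).measurable

theorem continuous_comp_nnreal {g : ℝ → ℝ} (hg : ContinuousOn g (Ioi 0)) (ω : Ω) :
    Continuous fun s : ℝ≥0 => g (X s ω) :=
  hg.comp_continuous (hX.continuous_paths ω) fun s => hX.pos s ω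

theorem continuous_comp {g : ℝ → ℝ} (hg : ContinuousOn g (Ioi 0)) (ω : Ω) :
    Continuous fun s : ℝ => g (X s.toNNReal ω) :=
  (hX.continuous_comp_nnreal hg ω).comp continuous_real_toNNReal

theorem measurable_comp {F : ℝ → ℝ} (hF : Measurable fun x : Ioi (0 : ℝ) => F x) (t : ℝ≥0) :
    Measurable[𝓕 t] fun ω => F (X t ω) :=
  measurable_comp_of_pos (m := 𝓕 t) hF (hX.measurable_apply t) (hX.pos t)

theorem measurable_uncurry : Measurable fun z : Ω × ℝ => X z.2.toNNReal z.1 := by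
  have : Measurable (Function.uncurry fun (s : ℝ) ω => X s.toNNReal ω) :=
    measurable_uncurry_of_continuous_of_measurable
      (fun ω => (hX.continuous_paths ω).comp continuous_real_toNNReal)
      fun s => (hX.measurable_apply _).mono (𝓕.le _) le_rfl
  exact this.comp measurable_swap

theorem measurable_discount (hr : ContinuousOn r (Ioi 0)) (t : ℝ≥0) :
    Measurable[𝓕 t] fun ω => discount r X t ω := by
  -- Stopping the time argument at `t` changes nothing on `[0,t]` and makes the integrand `𝓕
  -- t`-measurable for every `s`, so that the measurability lemma applies within `𝓕 t`.
  have h1 : (fun ω => discount r X t ω)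
      = fun ω => ∫ s in (0 : ℝ)..t, r (X (min s.toNNReal t) ω) := by
    funext ω
    refine intervalIntegral.integral_congr fun s hs => ?_
    rw [uIcc_of_le (NNReal.coe_nonneg t)] at hs
    have hst : s.toNNReal ≤ t := by
      rw [Real.toNNReal_le_iff_le_coe]; exact hs.2
    simp only [min_eq_left hst]
  rw [h1]
  refine measurable_integral_of_continuous (m := 𝓕 t)
    (Z := fun s ω => r (X (min s.toNNReal t) ω)) (fun ω => ?_) (fun s => ?_) _
  · exact (hX.continuous_comp_nnreal hr ω).comp (continuous_real_toNNReal.min continuous_const)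
  · exact (hX.measurable_comp (measurable_of_continuousOn_Ioi hr) _).mono
      (𝓕.mono (min_le_right _ _)) le_rfl

theorem measurable_discount_uncurry (hr : ContinuousOn r (Ioi 0)) :
    Measurable fun z : Ω × ℝ => discount r X z.2 z.1 := by
  have : Measurable (Function.uncurry fun (s : ℝ) ω => discount r X s ω) := by
    refine measurable_uncurry_of_continuous_of_measurable (fun ω => ?_) (fun t => ?_)
    · exact continuous_iff_continuousAt.2 fun s =>
        ((hX.continuous_comp hr ω).integral_hasStrictDerivAt 0 s).hasDerivAt.continuousAt
    · exact measurable_integral_of_continuous (Z := fun s ω => r (X s.toNNReal ω))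
        (fun ω => hX.continuous_comp hr ω)
        (fun s => (hX.measurable_comp (measurable_of_continuousOn_Ioi hr) _).mono (𝓕.le _) le_rfl) t
  exact this.comp measurable_swap

theorem ae_greenMeasure_pos : ∀ᵐ y ∂(greenMeasure r P X), 0 < y :=
  (ae_map_iff hX.measurable_uncurry.aemeasurable measurableSet_Ioi).2
    (Eventually.of_forall fun _ => hX.pos _ _)

/-- `F` is only assumed measurable on `]0,∞[`; as the measure lives there, `F` can be traded for a
function measurable on all of `ℝ`. -/
theorem ae_eq_indicator (F : ℝ → ℝ) : F =ᵐ[greenMeasure r P X] (Ioi (0 : ℝ)).indicator F := by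
  filter_upwards [hX.ae_greenMeasure_pos (r := r)] with y hy using (indicator_of_mem hy F).symm

theorem lintegral_greenMeasure (hr : ContinuousOn r (Ioi 0)) {F : ℝ → ℝ}
    (hF : Measurable fun x : Ioi (0 : ℝ) => F x) :
    ∫⁻ y, ‖F y‖ₑ ∂(greenMeasure r P X) = ∫⁻ ω, (∫⁻ t in Ioi (0 : ℝ),
      ENNReal.ofReal (Real.exp (-discount r X t ω) * |F (X t.toNNReal ω)|)) ∂P := by
  have := hX.prob
  have hF' := measurable_indicator_Ioi hF
  have hD : Measurable fun z : Ω × ℝ => ENNReal.ofReal (Real.exp (-discount r X z.2 z.1)) :=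
    (hX.measurable_discount_uncurry hr).neg.exp.ennreal_ofReal
  have hFX : Measurable fun z : Ω × ℝ => ‖(Ioi (0 : ℝ)).indicator F (X z.2.toNNReal z.1)‖ₑ :=
    (hF'.comp hX.measurable_uncurry).enorm
  have hcongr : (fun y => ‖F y‖ₑ) =ᵐ[greenMeasure r P X]
      fun y => ‖(Ioi (0 : ℝ)).indicator F y‖ₑ := (hX.ae_eq_indicator F).fun_comp (‖·‖ₑ)
  rw [lintegral_congr_ae hcongr, greenMeasure,
    lintegral_map hF'.enorm hX.measurable_uncurry,
    lintegral_withDensity_eq_lintegral_mul _ hD hFX,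
    lintegral_prod _ (hD.mul hFX).aemeasurable]
  refine lintegral_congr fun ω => lintegral_congr fun t => ?_
  have hpos : X t.toNNReal ω ∈ Ioi (0 : ℝ) := hX.pos _ _
  simp only [Pi.mul_apply, indicator_of_mem hpos]
  rw [ENNReal.ofReal_mul (Real.exp_pos _).le, Real.enorm_eq_ofReal_abs]

theorem integrable_greenMeasure_iff (hr : ContinuousOn r (Ioi 0)) {F : ℝ → ℝ}
    (hF : Measurable fun x : Ioi (0 : ℝ) => F x) :
    Integrable F (greenMeasure r P X) ↔ ∫⁻ ω, (∫⁻ t in Ioi (0 : ℝ),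
      ENNReal.ofReal (Real.exp (-discount r X t ω) * |F (X t.toNNReal ω)|)) ∂P < ⊤ := by
  rw [← hX.lintegral_greenMeasure hr hF]
  have : AEStronglyMeasurable F (greenMeasure r P X) :=
    (measurable_indicator_Ioi hF).aestronglyMeasurable.congr (hX.ae_eq_indicator F).symm
  exact ⟨fun h => h.2, fun h => ⟨this, h⟩⟩

theorem integral_greenMeasure (hr : ContinuousOn r (Ioi 0)) {F : ℝ → ℝ}
    (hF : Measurable fun x : Ioi (0 : ℝ) => F x) (hi : Integrable F (greenMeasure r P X)) :
    ∫ y, F y ∂(greenMeasure r P X) = ∫ ω, (∫ t in Ioi (0 : ℝ),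
      Real.exp (-discount r X t ω) * F (X t.toNNReal ω)) ∂P := by
  have := hX.prob
  have hF' := measurable_indicator_Ioi hF
  have hD : Measurable fun z : Ω × ℝ => ENNReal.ofReal (Real.exp (-discount r X z.2 z.1)) :=
    (hX.measurable_discount_uncurry hr).neg.exp.ennreal_ofReal
  have hi' : Integrable ((Ioi (0 : ℝ)).indicator F) (greenMeasure r P X) :=
    hi.congr (hX.ae_eq_indicator F)
  rw [integral_congr_ae (hX.ae_eq_indicator F)]
  rw [greenMeasure] at hi' ⊢
  rw [integrable_map_measure hF'.aestronglyMeasurable hX.measurable_uncurry.aemeasurable,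
    integrable_withDensity_iff_integrable_smul' hD (by simp)] at hi'
  rw [integral_map hX.measurable_uncurry.aemeasurable hF'.aestronglyMeasurable,
    integral_withDensity_eq_integral_toReal_smul hD (by simp)]
  refine (integral_prod _ hi').trans ?_
  refine integral_congr_ae (Eventually.of_forall fun ω => ?_)
  refine integral_congr_ae (Eventually.of_forall fun t => ?_)
  have hpos : X t.toNNReal ω ∈ Ioi (0 : ℝ) := hX.pos _ _
  simp only [Function.comp_apply, indicator_of_mem hpos, smul_eq_mul, ENNReal.toReal_ofReal (Real.exp_pos _).le]

end

/-- Multiplying the martingale of the martingale problem by the discount factor and taking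
expectations gives `E[f(X_t) D_t] - f(x) + E[∫₀ᵗ D (r f - L f)(X) ds] = 0`. As `t → ∞` the first
term vanishes because `D_t ≤ e^{-r₀ t}`, and the last converges by domination. -/
theorem isGreenMeasure (h : Admissible b σ r) (hX : IsDiffusion b σ x 𝓕 P X) :
    IsGreenMeasure b σ r x (greenMeasure r P X) := by
  have := hX.prob
  have hrc := h.continuousOn_r
  obtain ⟨r₀, hr₀, hr⟩ := h.r_lower
  obtain ⟨r₁, hr₁⟩ := h.r_upper
  have hrX : ∀ ω (s : ℝ), r₀ ≤ r (X s.toNNReal ω) := fun ω s => hr _ (hX.pos _ _).le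
  have hrX' : ∀ ω (s : ℝ), |r (X s.toNNReal ω)| ≤ r₁ := fun ω s => by
    rw [abs_of_nonneg (hr₀.le.trans (hrX ω s))]; exact hr₁ _ (hX.pos _ _).le
  have hfin : ∀ {g : ℝ → ℝ} {C : ℝ}, ContinuousOn g (Ioi 0) → (∀ y, 0 < y → |g y| ≤ C) →
      Integrable g (greenMeasure r P X) := by
    intro g C hg hC
    rw [hX.integrable_greenMeasure_iff hrc (measurable_of_continuousOn_Ioi hg)]
    have hi := (integrableOn_exp_mul_Ioi (neg_neg_of_pos hr₀) 0).mul_const C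
    calc _ ≤ ∫⁻ _, (∫⁻ t in Ioi (0 : ℝ), ENNReal.ofReal (Real.exp (-r₀ * t) * C)) ∂P := by
          refine lintegral_mono fun ω => setLIntegral_mono' measurableSet_Ioi fun t ht => ?_
          refine ENNReal.ofReal_le_ofReal (mul_le_mul ?_ (hC _ (hX.pos _ _)) (abs_nonneg _)
            (Real.exp_pos _).le)
          exact exp_neg_integral_le (hX.continuous_comp hrc ω) (hrX ω) (le_of_lt ht)
      _ < ⊤ := by
          rw [lintegral_const, measure_univ, mul_one]
          exact hi.lintegral_lt_top
  refine ⟨?_, hX.ae_greenMeasure_pos, ?_, ?_⟩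
  · have := hfin (g := fun _ => (1 : ℝ)) (C := 1) continuousOn_const (by simp)
    rwa [integrable_const_iff, or_iff_right one_ne_zero] at this
  · rw [hX.integral_greenMeasure hrc (measurable_of_continuousOn_Ioi hrc)
      (hfin hrc (C := r₁) fun y hy => by
        rw [abs_of_nonneg (hr₀.le.trans (hr y hy.le))]; exact hr₁ y hy.le)]
    have : ∀ ω, ∫ t in Ioi (0 : ℝ), Real.exp (-discount r X t ω) * r (X t.toNNReal ω) = 1 :=
      fun ω => integral_rate_mul_discount (hX.continuous_comp hrc ω) hr₀ (hrX ω) (hrX' ω)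
    simp [this]
  · intro f hf hfc hfs
    obtain ⟨hgc, C, hC⟩ := exists_bound_generator h hf hfc hfs
    obtain ⟨B, hB⟩ := hf.continuous.bounded_above_of_compact_support hfc
    have hB0 : 0 ≤ B := (norm_nonneg _).trans (hB 0)
    have hC0 : 0 ≤ C := (abs_nonneg _).trans (hC 0)
    set g := generator b σ f with hg
    set k := fun y => r y * f y - g y with hk
    have hfcont : ContinuousOn f (Ioi 0) := hf.continuous.continuousOn
    have hkc : ContinuousOn k (Ioi 0) := (hrc.mul hfcont).sub hgc
    have hr₁0 : 0 ≤ r₁ := hr₀.le.trans ((hr 0 le_rfl).trans (hr₁ 0 le_rfl))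
    have hkb : ∀ y, 0 < y → |k y| ≤ r₁ * B + C := fun y hy => by
      refine (abs_sub _ _).trans (add_le_add ?_ (hC y))
      rw [abs_mul, abs_of_nonneg (hr₀.le.trans (hr y hy.le))]
      exact mul_le_mul (hr₁ y hy.le) (hB y) (abs_nonneg _) hr₁0
    rw [hX.integral_greenMeasure hrc (measurable_of_continuousOn_Ioi hkc) (hfin hkc hkb)]
    set D : ℝ → Ω → ℝ := fun t ω => Real.exp (-discount r X t ω) with hD
    have hDle : ∀ (t : ℝ), 0 ≤ t → ∀ ω, D t ω ≤ Real.exp (-r₀ * t) := fun t ht ω =>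
      exp_neg_integral_le (hX.continuous_comp hrc ω) (hrX ω) ht
    have hDm : ∀ t : ℝ≥0, Measurable[𝓕 t] (D t) := fun t =>
      (hX.measurable_discount hrc t).neg.exp
    have hkint : ∀ ω, IntegrableOn (fun t : ℝ => D t ω * k (X t.toNNReal ω)) (Ioi 0) := fun ω =>
      integrableOn_discount (hX.continuous_comp hrc ω) hr₀ (hrX ω) (hX.continuous_comp hkc ω)
        fun s => hkb _ (hX.pos _ _)
    have hkcont : ∀ ω, Continuous fun t : ℝ => D t ω * k (X t.toNNReal ω) := fun ω =>
      (continuous_exp_neg_integral (hX.continuous_comp hrc ω)).mul (hX.continuous_comp hkc ω)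
    have hkm : ∀ t : ℝ≥0, Measurable fun ω => ∫ s in (0 : ℝ)..t, D s ω * k (X s.toNNReal ω) := by
      intro t
      refine measurable_integral_of_continuous (Z := fun s ω => D s ω * k (X s.toNNReal ω))
        hkcont (fun s => ?_) t
      refine Measurable.mul ?_
        ((hX.measurable_comp (measurable_of_continuousOn_Ioi hkc) _).mono (𝓕.le _) le_rfl)
      exact ((hX.measurable_discount_uncurry hrc).comp measurable_prodMk_right).neg.exp
    have hkle : ∀ (t : ℝ≥0) ω, ‖∫ s in (0 : ℝ)..t, D s ω * k (X s.toNNReal ω)‖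
        ≤ ∫ s in Ioi (0 : ℝ), Real.exp (-r₀ * s) * (r₁ * B + C) := by
      intro t ω
      have hi : IntegrableOn (fun s => Real.exp (-r₀ * s) * (r₁ * B + C)) (Ioi 0) :=
        (integrableOn_exp_mul_Ioi (neg_neg_of_pos hr₀) 0).mul_const (r₁ * B + C)
      rw [intervalIntegral.integral_of_le (NNReal.coe_nonneg t)]
      calc _ ≤ ∫ s in Ioc (0 : ℝ) t, Real.exp (-r₀ * s) * (r₁ * B + C) := by
            refine norm_integral_le_of_norm_le (hi.mono_set Ioc_subset_Ioi_self) ?_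
            filter_upwards [ae_restrict_mem measurableSet_Ioc] with s hs
            rw [norm_mul, Real.norm_of_nonneg (Real.exp_pos _).le]
            exact mul_le_mul (hDle s hs.1.le ω) (hkb _ (hX.pos _ _)) (abs_nonneg _)
              (Real.exp_pos _).le
        _ ≤ _ := setIntegral_mono_set hi
            (Eventually.of_forall fun s => by positivity)
            (Ioc_subset_Ioi_self.eventuallyLE)
    have hstep : ∀ t : ℝ≥0, ∫ ω, f (X t ω) * D t ω ∂P - f x
        + ∫ ω, (∫ s in (0 : ℝ)..t, D s ω * k (X s.toNNReal ω)) ∂P = 0 := by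
      intro t
      have hM := hX.martingale f hf hfc hfs
      have hgX := fun ω => hX.continuous_comp hgc ω
      -- `C` here bounds the martingale up to time `t`: two values of `f`, plus the generator
      -- integrated over at most time `t`.
      have key := integral_martingale_integral_mul hM
        (Z := fun s ω => r (X s ω) * D s ω) (c := r₁ * 1) (C := B + B + C * t)
        (fun ω => ?_) (fun ω => by simp) (fun s => ?_) (fun ω => ?_) (fun s ω => ?_) t
        (fun s hs ω => ?_)
      · have hpath : ∀ ω, _ := fun ω => sub_integral_mul_discount (hX.continuous_comp hrc ω)
          (hX.continuous_comp hfcont ω) (hX.continuous_comp hgc ω) t _ rfl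
        have hcong : ∀ ω, f (X t ω) - f (X 0 ω) - (∫ s in (0 : ℝ)..t, g (X s.toNNReal ω))
            - ∫ s in (0 : ℝ)..t, (f (X t ω) - f (X 0 ω)
                - (∫ s in (0 : ℝ)..t, g (X s.toNNReal ω))
              - (f (X s.toNNReal ω) - f (X 0 ω) - ∫ z in (0 : ℝ)..s.toNNReal, g (X z.toNNReal ω)))
              * (r (X s.toNNReal ω) * D s.toNNReal ω)
            = f (X t ω) * D t ω - f (X 0 ω)
              + ∫ s in (0 : ℝ)..t, D s ω * k (X s.toNNReal ω) := by
          intro ω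
          have h1 := hpath ω
          simp only [Real.toNNReal_coe, Real.toNNReal_zero] at h1
          refine Eq.trans ?_ h1
          congr 1
          refine intervalIntegral.integral_congr fun s hs => ?_
          rw [uIcc_of_le (NNReal.coe_nonneg t)] at hs
          simp only [Real.coe_toNNReal s hs.1]
          rfl
        have key : ∫ ω, (f (X t ω) * D t ω - f (X 0 ω)
            + ∫ s in (0 : ℝ)..t, D s ω * k (X s.toNNReal ω)) ∂P = 0 :=
          (integral_congr_ae (Eventually.of_forall fun ω => (hcong ω).symm)).trans key
        have hi1 : Integrable (fun ω => f (X t ω) * D t ω) P := by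
          refine Integrable.of_bound (C := B * 1) ?_ (Eventually.of_forall fun ω => ?_)
          · exact (((hX.measurable_comp (measurable_of_continuousOn_Ioi hfcont) t).mul
              (hDm t)).mono (𝓕.le t) le_rfl).aestronglyMeasurable
          · rw [norm_mul, Real.norm_of_nonneg (Real.exp_pos _).le]
            refine mul_le_mul (hB _) ((hDle t t.2 ω).trans ?_) (Real.exp_pos _).le hB0
            rw [Real.exp_le_one_iff]
            have := mul_nonneg hr₀.le t.2
            simp only [NNReal.val_eq_coe] at this
            linarith
        have hi2 : Integrable (fun ω => f (X 0 ω)) P :=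
          Integrable.of_bound (C := B) ((hX.measurable_comp (measurable_of_continuousOn_Ioi hfcont)
            0).mono (𝓕.le 0) le_rfl).aestronglyMeasurable (Eventually.of_forall fun ω => hB _)
        have hi3 : Integrable (fun ω => ∫ s in (0 : ℝ)..t, D s ω * k (X s.toNNReal ω)) P :=
          Integrable.of_bound (hkm t).aestronglyMeasurable _ (Eventually.of_forall (hkle t))
        have hi12 : Integrable (fun ω => f (X t ω) * D t ω - f (X 0 ω)) P := hi1.sub hi2
        rw [integral_add hi12 hi3, integral_sub hi1 hi2] at key
        have hstart : ∫ ω, f (X 0 ω) ∂P = f x := by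
          rw [integral_congr_ae (g := fun _ => f x)]
          · simp
          · filter_upwards [hX.start] with ω hω
            rw [hω]
        rw [hstart] at key
        exact key
      · have : Continuous fun s : ℝ => ∫ z in (0 : ℝ)..s, g (X z.toNNReal ω) :=
          continuous_iff_continuousAt.2 fun s =>
            ((hgX ω).integral_hasStrictDerivAt 0 s).hasDerivAt.continuousAt
        exact ((hX.continuous_comp_nnreal hfcont ω).sub continuous_const).sub
          (this.comp NNReal.continuous_coe)
      · exact (hX.measurable_comp (measurable_of_continuousOn_Ioi hrc) s).mul (hDm s)
      · exact (hX.continuous_comp_nnreal hrc ω).mul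
          ((continuous_exp_neg_integral (hX.continuous_comp hrc ω)).comp NNReal.continuous_coe)
      · rw [abs_mul]
        have h1 := hrX' ω s
        rw [Real.toNNReal_coe] at h1
        refine mul_le_mul h1 ?_ (abs_nonneg _) hr₁0
        rw [abs_of_pos (Real.exp_pos _)]
        refine (hDle s s.2 ω).trans ?_
        rw [Real.exp_le_one_iff]
        have := mul_nonneg hr₀.le s.2
        simp only [NNReal.val_eq_coe] at this
        linarith
      · refine (abs_sub _ _).trans (add_le_add ((abs_sub _ _).trans (add_le_add (hB _) (hB _))) ?_)
        have h1 := intervalIntegral.norm_integral_le_of_norm_le_const (a := (0 : ℝ)) (b := (s : ℝ))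
          (f := fun z => g (X z.toNNReal ω)) (C := C) fun z _ => hC _
        refine h1.trans ?_
        rw [sub_zero, abs_of_nonneg (NNReal.coe_nonneg s)]
        exact mul_le_mul_of_nonneg_left (NNReal.coe_le_coe.2 hs) hC0
    have hlim1 : Tendsto (fun n : ℕ => ∫ ω, f (X n ω) * D (n : ℝ≥0) ω ∂P) atTop (𝓝 0) := by
      have hexp : Tendsto (fun n : ℕ => B * Real.exp (-r₀ * n)) atTop (𝓝 (B * 0)) := by
        refine Tendsto.const_mul B (Real.tendsto_exp_atBot.comp ?_)
        exact tendsto_natCast_atTop_atTop.const_mul_atTop_of_neg (neg_neg_of_pos hr₀)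
      rw [mul_zero] at hexp
      refine squeeze_zero_norm (fun n => ?_) hexp
      refine (norm_integral_le_of_norm_le_const (C := B * Real.exp (-r₀ * n))
        (Eventually.of_forall fun ω => ?_)).trans (by simp)
      rw [norm_mul, Real.norm_of_nonneg (Real.exp_pos _).le]
      refine mul_le_mul (hB _) ?_ (Real.exp_pos _).le hB0
      exact hDle n (Nat.cast_nonneg n) ω
    have hlim2 : Tendsto (fun n : ℕ => ∫ ω, (∫ s in (0 : ℝ)..(n : ℝ≥0),
        D s ω * k (X s.toNNReal ω)) ∂P) atTop
        (𝓝 (∫ ω, (∫ s in Ioi (0 : ℝ), D s ω * k (X s.toNNReal ω)) ∂P)) := by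
      refine tendsto_integral_of_dominated_convergence _
        (fun n => (hkm n).aestronglyMeasurable) (integrable_const _)
        (fun n => Eventually.of_forall (hkle n)) (Eventually.of_forall fun ω => ?_)
      exact intervalIntegral_tendsto_integral_Ioi 0 (hkint ω) tendsto_natCast_atTop_atTop
    have hlim := (hlim1.sub_const (f x)).add hlim2
    have hzero := tendsto_nhds_unique hlim
      (tendsto_const_nhds.congr fun n : ℕ => (hstep n).symm)
    change ∫ ω, (∫ s in Ioi (0 : ℝ), D s ω * k (X s.toNNReal ω)) ∂P = f x
    linarith

end IsDiffusion

/-! ### Fundamental solutions and the Green potential -/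

/-- A positive solution `v` of `L v = r v` together with `q = v' / p'`, where `v' (1) = 0`. -/
structure IsFundamental (b σ r v q : ℝ → ℝ) : Prop where
  deriv_v : ∀ x, 0 < x → HasDerivAt v (scaleDeriv b σ x * q x) x
  deriv_q : ∀ x, 0 < x → HasDerivAt q (r x * v x * speedDensity b σ x) x
  q_one : q 1 = 0
  one_le : ∀ x, 0 < x → 1 ≤ v x

theorem Admissible.exists_isFundamental {b σ r : ℝ → ℝ} (h : Admissible b σ r) :
    ∃ v q, IsFundamental b σ r v q := by
  obtain ⟨r₀, hr₀, hr⟩ := h.r_lower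
  let A : ℝ → (ℝ × ℝ) →L[ℝ] (ℝ × ℝ) := fun t =>
    scaleDeriv b σ t • (ContinuousLinearMap.inl ℝ ℝ ℝ).comp (ContinuousLinearMap.snd ℝ ℝ ℝ)
    + (r t * speedDensity b σ t) •
      (ContinuousLinearMap.inr ℝ ℝ ℝ).comp (ContinuousLinearMap.fst ℝ ℝ ℝ)
  have hA : ContinuousOn A (Ioi 0) :=
    (h.continuousOn_scaleDeriv.smul continuousOn_const).add
      ((h.continuousOn_r.mul h.continuousOn_speedDensity).smul continuousOn_const)
  obtain ⟨y, hy1, hy⟩ := exists_hasDerivAt_linear isOpen_Ioi ordConnected_Ioi hA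
    (mem_Ioi.2 (one_pos (α := ℝ))) ((1, 0) : ℝ × ℝ)
  set v := fun t => (y t).1 with hv
  set q := fun t => (y t).2 with hq
  have hvd : ∀ x, 0 < x → HasDerivAt v (scaleDeriv b σ x * q x) x := fun x hx => by
    have := (ContinuousLinearMap.fst ℝ ℝ ℝ).hasFDerivAt.comp_hasDerivAt x (hy x hx)
    refine this.congr_deriv ?_
    simp [A, q]
  have hqd : ∀ x, 0 < x → HasDerivAt q (r x * v x * speedDensity b σ x) x := fun x hx => by
    have := (ContinuousLinearMap.snd ℝ ℝ ℝ).hasFDerivAt.comp_hasDerivAt x (hy x hx)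
    refine this.congr_deriv ?_
    simp [A, v]
    ring
  have hv1 : v 1 = 1 := by simp [hv, hy1]
  have hq1 : q 1 = 0 := by simp [hq, hy1]
  -- Positivity of `v` comes from an energy argument that needs no sign in advance. The derivative
  -- of `v q` is `p' q² + r v² m' ≥ 0`, and `v q` vanishes at `1`. Since `(v²)' = 2 p' v q`, the
  -- function `v²` has its minimum `1` at `1`; by continuity `v` cannot change sign.
  have hEd : ∀ x, 0 < x → HasDerivAt (fun x => v x * q x)
      (scaleDeriv b σ x * q x * q x + v x * (r x * v x * speedDensity b σ x)) x := fun x hx =>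
    (hvd x hx).mul (hqd x hx)
  have hE : MonotoneOn (fun x => v x * q x) (Ioi 0) := by
    refine monotoneOn_of_deriv_nonneg (convex_Ioi 0)
      (fun x hx => (hEd x hx).continuousAt.continuousWithinAt)
      (fun x hx => ?_) (fun x hx => ?_)
    · rw [interior_Ioi] at hx
      exact (hEd x hx).differentiableAt.differentiableWithinAt
    · rw [interior_Ioi] at hx
      have hx0 : 0 < x := hx
      rw [(hEd x hx).deriv, mul_assoc, show v x * (r x * v x * speedDensity b σ x)
        = r x * speedDensity b σ x * (v x * v x) by ring]
      have h1 := (scaleDeriv_pos (b := b) (σ := σ) x).le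
      have h2 := (h.speedDensity_pos hx).le
      have h3 := hr₀.le.trans (hr x hx0.le)
      exact add_nonneg (mul_nonneg h1 (mul_self_nonneg _))
        (mul_nonneg (mul_nonneg h3 h2) (mul_self_nonneg _))
  have hNd : ∀ x, 0 < x → HasDerivAt (fun x => v x * v x)
      (2 * scaleDeriv b σ x * (v x * q x)) x := fun x hx =>
    ((hvd x hx).mul (hvd x hx)).congr_deriv (by ring)
  have hN : ∀ x, 0 < x → 1 ≤ v x * v x := by
    intro x hx
    have h1 : v 1 * v 1 = 1 := by rw [hv1, one_mul]
    rcases le_total 1 x with hx1 | hx1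
    · have : MonotoneOn (fun x => v x * v x) (Ici 1) := by
        refine monotoneOn_of_deriv_nonneg (convex_Ici 1)
          (fun x hx => (hNd x (one_pos.trans_le hx)).continuousAt.continuousWithinAt)
          (fun x hx => ?_) (fun x hx => ?_)
        · rw [interior_Ici] at hx
          exact (hNd x (one_pos.trans hx)).differentiableAt.differentiableWithinAt
        · rw [interior_Ici] at hx
          have hx0 : 0 < x := one_pos.trans hx
          have hx1 : 1 < x := hx
          rw [(hNd x hx0).deriv]
          have h2 := hE (mem_Ioi.2 (one_pos (α := ℝ))) hx0 hx1.le
          simp only [hq1, mul_zero] at h2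
          exact mul_nonneg (mul_nonneg two_pos.le (scaleDeriv_pos x).le) h2
      have := this (self_mem_Ici (a := (1 : ℝ))) hx1 hx1
      simp only [h1] at this
      exact this
    · have : AntitoneOn (fun x => v x * v x) (Ioc 0 1) := by
        refine antitoneOn_of_deriv_nonpos (convex_Ioc 0 1)
          (fun x hx => (hNd x hx.1).continuousAt.continuousWithinAt)
          (fun x hx => ?_) (fun x hx => ?_)
        · rw [interior_Ioc] at hx
          exact (hNd x hx.1).differentiableAt.differentiableWithinAt
        · rw [interior_Ioc] at hx
          rw [(hNd x hx.1).deriv]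
          have h2 := hE hx.1 (mem_Ioi.2 (one_pos (α := ℝ))) hx.2.le
          simp only [hq1, mul_zero] at h2
          exact mul_nonpos_of_nonneg_of_nonpos (mul_nonneg two_pos.le (scaleDeriv_pos x).le) h2
      have := this ⟨hx, hx1⟩ (show (1 : ℝ) ∈ Ioc 0 1 from ⟨one_pos, le_rfl⟩) hx1
      simp only [h1] at this
      exact this
  refine ⟨v, q, hvd, hqd, hq1, fun x hx => ?_⟩
  have hvc : ContinuousOn v (Ioi 0) := fun x hx => (hvd x hx).continuousAt.continuousWithinAt
  have hpos : 0 < v x := by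
    by_contra! hneg
    obtain ⟨z, hz, hz0⟩ := isPreconnected_Ioi.intermediate_value hx
      (mem_Ioi.2 (one_pos (α := ℝ))) hvc (show (0 : ℝ) ∈ Icc (v x) (v 1) from
        ⟨hneg, by rw [hv1]; exact zero_le_one⟩)
    have := hN z hz
    rw [hz0] at this
    norm_num at this
  have := hN x hx
  nlinarith

namespace IsFundamental

variable {b σ r v q : ℝ → ℝ} (h : Admissible b σ r) (hv : IsFundamental b σ r v q)
include hv

theorem v_pos {x : ℝ} (hx : 0 < x) : 0 < v x := one_pos.trans_le (hv.one_le x hx)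

theorem continuousOn_v : ContinuousOn v (Ioi 0) :=
  fun x hx => (hv.deriv_v x hx).continuousAt.continuousWithinAt

theorem continuousOn_q : ContinuousOn q (Ioi 0) :=
  fun x hx => (hv.deriv_q x hx).continuousAt.continuousWithinAt

include h

theorem strictMonoOn_q : StrictMonoOn q (Ioi 0) := by
  obtain ⟨r₀, hr₀, hr⟩ := h.r_lower
  refine strictMonoOn_of_deriv_pos (convex_Ioi 0) hv.continuousOn_q fun x hx => ?_
  rw [interior_Ioi] at hx
  rw [(hv.deriv_q x hx).deriv]
  have h3 := hr₀.trans_le (hr x (le_of_lt hx))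
  exact mul_pos (mul_pos h3 (hv.v_pos hx)) (h.speedDensity_pos hx)

theorem q_neg {x : ℝ} (hx : 0 < x) (hx1 : x < 1) : q x < 0 := by
  have := hv.strictMonoOn_q h hx (mem_Ioi.2 (one_pos (α := ℝ))) hx1
  rwa [hv.q_one] at this

theorem q_pos {x : ℝ} (hx1 : 1 < x) : 0 < q x := by
  have := hv.strictMonoOn_q h (mem_Ioi.2 (one_pos (α := ℝ))) (one_pos.trans hx1 : 0 < x) hx1
  rwa [hv.q_one] at this

theorem continuousOn_scaleDeriv_div : ContinuousOn (fun y => scaleDeriv b σ y / v y ^ 2) (Ioi 0) :=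
  h.continuousOn_scaleDeriv.div (hv.continuousOn_v.pow 2)
    fun _ hx => (pow_pos (hv.v_pos hx) 2).ne'

/-- A primitive `R` of `p' / v²` that vanishes at `0`, so that `v R` and `v (T - R)` are the
increasing and the decreasing solution of `L u = r u`. -/
theorem exists_primitive : ∃ (R : ℝ → ℝ) (T : ℝ), 0 < T ∧
    (∀ x, 0 < x → HasDerivAt R (scaleDeriv b σ x / v x ^ 2) x) ∧ (∀ x, 0 < x → 0 < R x) ∧
    (∀ x, 0 < x → R x ≤ T) ∧
    (∀ x, 0 < x → x < 1 → v x * R x ≤ 1 / (-q x)) ∧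
    (∀ x, 1 < x → v x * (T - R x) ≤ 1 / q x) := by
  have hρc := hv.continuousOn_scaleDeriv_div h
  set ρ := fun y => scaleDeriv b σ y / v y ^ 2 with hρ
  set R₀ := fun x => ∫ y in (1 : ℝ)..x, ρ y with hR₀
  have hρpos : ∀ y, 0 < y → 0 < ρ y := fun y hy =>
    div_pos (scaleDeriv_pos y) (pow_pos (hv.v_pos hy) 2)
  have hRd : ∀ x, 0 < x → HasDerivAt R₀ (ρ x) x := fun x hx =>
    hasDerivAt_integral_of_continuousOn_Ioi hρc one_pos hx
  have hRm : StrictMonoOn R₀ (Ioi 0) := by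
    refine strictMonoOn_of_deriv_pos (convex_Ioi 0)
      (fun x hx => (hRd x hx).continuousAt.continuousWithinAt) fun x hx => ?_
    rw [interior_Ioi] at hx
    rw [(hRd x hx).deriv]
    exact hρpos x hx
  have hvinv : ∀ x, 0 < x → HasDerivAt (fun y => (v y)⁻¹) (-(q x * ρ x)) x := fun x hx =>
    ((hv.deriv_v x hx).inv (hv.v_pos hx).ne').congr_deriv (by simp only [hρ]; ring)
  -- Since `(1/v)' = -q ρ` and `-q ≥ -q x` on `]0,x]`, integration gives `-q x (R₀ x - R₀ a) ≤ 1/v x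
  -- - 1/v a ≤ 1/v x`. So `R₀` is bounded below near `0`, with a quantitative bound; `hright` is the
  -- mirror image at infinity.
  have hleft : ∀ x, 0 < x → x < 1 → ∀ a, 0 < a → R₀ x - (1 / (-q x)) / v x ≤ R₀ a := by
    intro x hx hx1 a ha
    have hqx : 0 < -q x := neg_pos.2 (hv.q_neg h hx hx1)
    have hB : 0 ≤ (1 / (-q x)) / v x := by have := hv.v_pos hx; positivity
    rcases le_total x a with hxa | hax
    · have := hRm.monotoneOn hx ha hxa
      linarith
    · have hmono : AntitoneOn (fun y => -q x * R₀ y - (v y)⁻¹) (Ioc 0 x) := by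
        have hd : ∀ y, 0 < y → HasDerivAt (fun y => -q x * R₀ y - (v y)⁻¹)
            (-q x * ρ y - -(q y * ρ y)) y := fun y hy =>
          ((hRd y hy).const_mul (-q x)).sub (hvinv y hy)
        refine antitoneOn_of_deriv_nonpos (convex_Ioc 0 x)
          (fun y hy => (hd y hy.1).continuousAt.continuousWithinAt)
          (fun y hy => ?_) (fun y hy => ?_)
        · rw [interior_Ioc] at hy
          exact (hd y hy.1).differentiableAt.differentiableWithinAt
        · rw [interior_Ioc] at hy
          rw [(hd y hy.1).deriv]
          have h1 := (hv.strictMonoOn_q h).monotoneOn hy.1 hx hy.2.le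
          have h2 := (hρpos y hy.1).le
          nlinarith
      have h1 := hmono ⟨ha, hax⟩ ⟨hx, le_rfl⟩ hax
      simp only at h1
      have h2 : 0 < (v a)⁻¹ := inv_pos.2 (hv.v_pos ha)
      have h3 : (1 / (-q x)) / v x = (v x)⁻¹ / (-q x) := by
        have := (hv.v_pos hx).ne'
        field_simp
      rw [h3, sub_le_iff_le_add, ← sub_le_iff_le_add', le_div_iff₀ hqx]
      linarith
  have hright : ∀ x, 1 < x → ∀ c, 0 < c → R₀ c ≤ R₀ x + (1 / q x) / v x := by
    intro x hx1 c hc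
    have hx : 0 < x := one_pos.trans hx1
    have hqx : 0 < q x := hv.q_pos h hx1
    have hB : 0 ≤ (1 / q x) / v x := by have := hv.v_pos hx; positivity
    rcases le_total c x with hcx | hxc
    · have := hRm.monotoneOn hc hx hcx
      linarith
    · have hmono : AntitoneOn (fun y => q x * R₀ y + (v y)⁻¹) (Ici x) := by
        have hd : ∀ y, 0 < y → HasDerivAt (fun y => q x * R₀ y + (v y)⁻¹)
            (q x * ρ y + -(q y * ρ y)) y := fun y hy =>
          ((hRd y hy).const_mul (q x)).add (hvinv y hy)
        refine antitoneOn_of_deriv_nonpos (convex_Ici x)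
          (fun y hy => (hd y (hx.trans_le hy)).continuousAt.continuousWithinAt)
          (fun y hy => ?_) (fun y hy => ?_)
        · rw [interior_Ici] at hy
          exact (hd y (hx.trans hy)).differentiableAt.differentiableWithinAt
        · rw [interior_Ici] at hy
          have hy0 : 0 < y := hx.trans hy
          rw [(hd y hy0).deriv]
          have h1 := (hv.strictMonoOn_q h).monotoneOn hx hy0 (le_of_lt hy)
          have h2 := (hρpos y hy0).le
          nlinarith
      have h1 := hmono (self_mem_Ici (a := x)) hxc hxc
      simp only at h1
      have h2 : 0 < (v c)⁻¹ := inv_pos.2 (hv.v_pos hc)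
      have h3 : (1 / q x) / v x = (v x)⁻¹ / q x := by
        have := (hv.v_pos hx).ne'
        field_simp
      rw [h3, ← sub_le_iff_le_add', le_div_iff₀ hqx]
      linarith
  have hne : (R₀ '' Ioi 0).Nonempty := ⟨_, mem_image_of_mem _ (mem_Ioi.2 (one_pos (α := ℝ)))⟩
  have hbb : BddBelow (R₀ '' Ioi 0) := by
    refine ⟨R₀ (1 / 2) - (1 / (-q (1 / 2))) / v (1 / 2), ?_⟩
    rintro _ ⟨a, ha, rfl⟩
    exact hleft _ (by norm_num) (by norm_num) a ha
  have hba : BddAbove (R₀ '' Ioi 0) := by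
    refine ⟨R₀ 2 + (1 / q 2) / v 2, ?_⟩
    rintro _ ⟨a, ha, rfl⟩
    exact hright _ (by norm_num) a ha
  have hlow : ∀ x, 0 < x → sInf (R₀ '' Ioi 0) < R₀ x := fun x hx =>
    (csInf_le hbb (mem_image_of_mem _ (show x / 2 ∈ Ioi 0 from half_pos hx))).trans_lt
      (hRm (show x / 2 ∈ Ioi 0 from half_pos hx) hx (half_lt_self hx))
  have hupp : ∀ x, 0 < x → R₀ x ≤ sSup (R₀ '' Ioi 0) := fun x hx =>
    le_csSup hba (mem_image_of_mem _ hx)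
  refine ⟨fun x => R₀ x - sInf (R₀ '' Ioi 0), sSup (R₀ '' Ioi 0) - sInf (R₀ '' Ioi 0),
    ?_, fun x hx => (hRd x hx).sub_const _, fun x hx => sub_pos.2 (hlow x hx),
    fun x hx => sub_le_sub_right (hupp x hx) _, fun x hx hx1 => ?_, fun x hx1 => ?_⟩
  · have h1 := hlow 1 one_pos
    have h2 := hupp 1 one_pos
    linarith
  · have : R₀ x - (1 / (-q x)) / v x ≤ sInf (R₀ '' Ioi 0) := by
      refine le_csInf hne ?_
      rintro _ ⟨a, ha, rfl⟩
      exact hleft x hx hx1 a ha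
    rw [mul_comm, ← le_div_iff₀ (hv.v_pos hx)]
    linarith
  · have : sSup (R₀ '' Ioi 0) ≤ R₀ x + (1 / q x) / v x := by
      refine csSup_le hne ?_
      rintro _ ⟨a, ha, rfl⟩
      exact hright x hx1 a ha
    rw [mul_comm, ← le_div_iff₀ (hv.v_pos (one_pos.trans hx1))]
    linarith

/-- On `]0,1]` the solution `v` dominates a multiple of `p(1) - p`. Hence `-q(x) = ∫ₓ¹ r v m'`
dominates a multiple of `∫ₓ¹ (p(1) - p) dm`, which diverges exactly because `0` is natural. -/
theorem tendsto_neg_q (hnat : ZeroNatural b σ) : Tendsto (fun x => -q x) (𝓝[>] 0) atTop := by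
  obtain ⟨r₀, hr₀, hr⟩ := h.r_lower
  have hsd : ∀ x, 0 < x → HasDerivAt (scale b σ) (scaleDeriv b σ x) x := fun x hx =>
    hasDerivAt_integral_of_continuousOn_Ioi h.continuousOn_scaleDeriv one_pos hx
  have hs1 : scale b σ 1 = 0 := intervalIntegral.integral_same
  have hsc : ContinuousOn (scale b σ) (Ioi 0) :=
    fun x hx => (hsd x hx).continuousAt.continuousWithinAt
  have hsm : MonotoneOn (scale b σ) (Ioi 0) := by
    refine monotoneOn_of_deriv_nonneg (convex_Ioi 0) hsc (fun x hx => ?_) fun x hx => ?_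
    · rw [interior_Ioi] at hx
      exact (hsd x hx).differentiableAt.differentiableWithinAt
    · rw [interior_Ioi] at hx
      rw [(hsd x hx).deriv]
      exact (scaleDeriv_pos x).le
  set c := -q (1 / 2) with hc
  -- On `]0,1/2]` one has `v' = p' q ≤ -c p'`, so `v + c p` is nonincreasing there and `p(1/2) - p ≤
  -- v/c`. The second summand of `C` covers `p(1) - p(1/2)`, using `v ≥ 1`.
  have hc0 : 0 < c := neg_pos.2 (hv.q_neg h (by norm_num) (by norm_num))
  set C := 1 / c + |scale b σ (1 / 2)| with hC
  have hC0 : 0 < C := by positivity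
  have hSv : ∀ y, 0 < y → y ≤ 1 → scale b σ 1 - scale b σ y ≤ C * v y := by
    intro y hy hy1
    have h1 := hv.one_le y hy
    have h2 : -scale b σ (1 / 2) ≤ |scale b σ (1 / 2)| * v y :=
      (neg_le_abs _).trans (le_mul_of_one_le_right (abs_nonneg _) h1)
    have h3 : 0 ≤ 1 / c * v y := by positivity
    rw [hs1, hC, add_mul]
    rcases le_total (1 / 2) y with hy2 | hy2
    · have := hsm (show (1 / 2 : ℝ) ∈ Ioi 0 by norm_num) hy hy2
      linarith
    · have hmono : AntitoneOn (fun y => v y + c * scale b σ y) (Ioc 0 (1 / 2)) := by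
        have hd : ∀ y, 0 < y → HasDerivAt (fun y => v y + c * scale b σ y)
            (scaleDeriv b σ y * q y + c * scaleDeriv b σ y) y := fun y hy =>
          (hv.deriv_v y hy).add ((hsd y hy).const_mul c)
        refine antitoneOn_of_deriv_nonpos (convex_Ioc _ _)
          (fun y hy => (hd y hy.1).continuousAt.continuousWithinAt)
          (fun y hy => ?_) (fun y hy => ?_)
        · rw [interior_Ioc] at hy
          exact (hd y hy.1).differentiableAt.differentiableWithinAt
        · rw [interior_Ioc] at hy
          rw [(hd y hy.1).deriv]
          have h1 := (hv.strictMonoOn_q h).monotoneOn hy.1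
            (show (1 / 2 : ℝ) ∈ Ioi 0 by norm_num) hy.2.le
          have h2 := (scaleDeriv_pos (b := b) (σ := σ) y).le
          nlinarith
      have h4 := hmono ⟨hy, hy2⟩ (show (1 / 2 : ℝ) ∈ Ioc 0 (1 / 2) by norm_num) hy2
      simp only at h4
      have h5 := hv.one_le (1 / 2) (by norm_num)
      have h6 : scale b σ (1 / 2) - scale b σ y ≤ 1 / c * v y := by
        rw [one_div_mul_eq_div, le_div_iff₀ hc0]
        linarith
      linarith
  have hgc : ContinuousOn (fun y => speedDensity b σ y * (scale b σ 1 - scale b σ y)) (Ioi 0) :=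
    h.continuousOn_speedDensity.mul (continuousOn_const.sub hsc)
  have hrvm : ContinuousOn (fun y => r y * v y * speedDensity b σ y) (Ioi 0) :=
    (h.continuousOn_r.mul hv.continuousOn_v).mul h.continuousOn_speedDensity
  have hlim := tendsto_integral_zero_of_lintegral_eq_top hgc (fun x hx hx1 =>
    mul_nonneg (h.speedDensity_pos hx).le
      (sub_nonneg.2 (hsm hx (mem_Ioi.2 (one_pos (α := ℝ))) hx1.le))) (by
    have hsub : Ioo (0 : ℝ) 1 ⊆ Ioi 0 := fun x hx => hx.1
    have hm : AEMeasurable (fun x => ENNReal.ofReal (2 / (σ x ^ 2 * scaleDeriv b σ x)))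
        (volume.restrict (Ioo (0 : ℝ) 1)) :=
      ((h.continuousOn_speedDensity.mono hsub).aemeasurable measurableSet_Ioo).ennreal_ofReal
    rw [← hnat.2, speedMeasure, restrict_withDensity measurableSet_Ioo,
      Measure.restrict_restrict measurableSet_Ioo, inter_eq_self_of_subset_left hsub,
      lintegral_withDensity_eq_lintegral_mul_non_measurable₀ _ hm (by simp)]
    refine setLIntegral_congr_fun measurableSet_Ioo fun y hy => ?_
    simp only [Pi.mul_apply]
    rw [ENNReal.ofReal_mul (h.speedDensity_pos hy.1).le]
    rfl)
  have hlim' := hlim.const_mul_atTop (show 0 < r₀ / C by positivity)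
  refine tendsto_atTop_mono' _ ?_ hlim'
  filter_upwards [Ioo_mem_nhdsGT one_pos] with x hx
  have hq : ∫ y in x..1, r y * v y * speedDensity b σ y = -q x := by
    rw [intervalIntegral.integral_eq_sub_of_hasDerivAt (f := q)
      (fun y hy => hv.deriv_q y (uIcc_subset_Ioi_zero hx.1 one_pos hy))
      (intervalIntegrable_of_continuousOn_Ioi hrvm hx.1 one_pos), hv.q_one, zero_sub]
  rw [← hq, ← intervalIntegral.integral_const_mul]
  refine intervalIntegral.integral_mono_on hx.2.le
    ((intervalIntegrable_of_continuousOn_Ioi hgc hx.1 one_pos).const_mul _)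
    (intervalIntegrable_of_continuousOn_Ioi hrvm hx.1 one_pos) fun y hy => ?_
  have hy0 : 0 < y := hx.1.trans_le hy.1
  have h1 := hSv y hy0 hy.2
  have h2 := (h.speedDensity_pos hy0).le
  have h3 := hr y hy0.le
  have h4 := (hv.v_pos hy0).le
  calc r₀ / C * (speedDensity b σ y * (scale b σ 1 - scale b σ y))
      ≤ r₀ / C * (speedDensity b σ y * (C * v y)) := by gcongr
    _ = r₀ * v y * speedDensity b σ y := by field_simp
    _ ≤ r y * v y * speedDensity b σ y := by gcongr

/-- The Green potential of a function with compact support in `]δ,∞[` is a multiple of the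
increasing solution `v R` on `]0,δ]`. -/
theorem exists_integral_eq {R : ℝ → ℝ} {T : ℝ} (hT : 0 < T)
    (hRd : ∀ x, 0 < x → HasDerivAt R (scaleDeriv b σ x / v x ^ 2) x)
    (hR0 : ∀ x, 0 < x → 0 < R x) (hRT : ∀ x, 0 < x → R x ≤ T)
    (hRl : ∀ x, 0 < x → x < 1 → v x * R x ≤ 1 / (-q x))
    (hRr : ∀ x, 1 < x → v x * (T - R x) ≤ 1 / q x)
    {δ M : ℝ} (hδ : 0 < δ) (hδM : δ ≤ M) {g : ℝ → ℝ} (hg : Continuous g) {B : ℝ}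
    (hB : ∀ y, |g y| ≤ B) (hgl : ∀ y, y ≤ δ → g y = 0) (hgr : ∀ y, M ≤ y → g y = 0) :
    ∃ κ : ℝ, ∀ x, 0 < x → x ≤ δ → ∀ G, IsGreenMeasure b σ r x G →
      ∫ y, g y ∂G = κ * (v x * R x) := by
  have hM : 0 < M := hδ.trans_le hδM
  have hρc := hv.continuousOn_scaleDeriv_div h
  set ρ := fun y => scaleDeriv b σ y / v y ^ 2 with hρ
  have hkc : ContinuousOn (fun y => g y * v y * speedDensity b σ y) (Ioi 0) :=
    (hg.continuousOn.mul hv.continuousOn_v).mul h.continuousOn_speedDensity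
  -- Variation of constants: `u = v U` solves `r u - L u = g` when `U' = (κ - H) ρ`. Both `H` and
  -- `J` vanish to the left of `δ`, which leaves `u = κ v R` there.
  set H := fun x => ∫ y in δ..x, g y * v y * speedDensity b σ y with hH
  have hHd : ∀ x, 0 < x → HasDerivAt H (g x * v x * speedDensity b σ x) x := fun x hx =>
    hasDerivAt_integral_of_continuousOn_Ioi hkc hδ hx
  have hHc : ContinuousOn H (Ioi 0) := fun x hx => (hHd x hx).continuousAt.continuousWithinAt
  have hHl : ∀ x, x ≤ δ → H x = 0 := by
    intro x hx
    simp only [hH]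
    rw [intervalIntegral.integral_congr (g := fun _ => (0 : ℝ))]
    · simp
    · intro y hy
      rw [uIcc_of_ge hx] at hy
      simp [hgl y hy.2]
  have hHr : ∀ x, M ≤ x → H x = H M := by
    intro x hx
    simp only [hH]
    rw [← intervalIntegral.integral_add_adjacent_intervals
      (intervalIntegrable_of_continuousOn_Ioi hkc hδ hM)
      (intervalIntegrable_of_continuousOn_Ioi hkc hM (hM.trans_le hx)), add_eq_left,
      intervalIntegral.integral_congr (g := fun _ => (0 : ℝ))]
    · simp
    · intro y hy
      rw [uIcc_of_le hx] at hy
      simp [hgr y hy.1]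
  have hHρ : ContinuousOn (fun y => H y * ρ y) (Ioi 0) := hHc.mul hρc
  set J := fun x => ∫ y in δ..x, H y * ρ y with hJ
  have hJd : ∀ x, 0 < x → HasDerivAt J (H x * ρ x) x := fun x hx =>
    hasDerivAt_integral_of_continuousOn_Ioi hHρ hδ hx
  have hJl : ∀ x, 0 < x → x ≤ δ → J x = 0 := by
    intro x _ hx
    simp only [hJ]
    rw [intervalIntegral.integral_congr (g := fun _ => (0 : ℝ))]
    · simp
    · intro y hy
      rw [uIcc_of_ge hx] at hy
      simp [hHl y hy.2]
  have hJr : ∀ x, M ≤ x → J x = J M + H M * (R x - R M) := by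
    intro x hx
    have e : ∫ y in M..x, H y * ρ y = H M * (R x - R M) := by
      rw [intervalIntegral.integral_congr (g := fun y => H M * ρ y),
        intervalIntegral.integral_const_mul,
        intervalIntegral.integral_eq_sub_of_hasDerivAt (f := R)
        (fun y hy => hRd y (uIcc_subset_Ioi_zero hM (hM.trans_le hx) hy))
        (intervalIntegrable_of_continuousOn_Ioi hρc hM (hM.trans_le hx))]
      intro y hy
      rw [uIcc_of_le hx] at hy
      simp [hHr y hy.1]
    simp only [hJ]
    rw [← e, intervalIntegral.integral_add_adjacent_intervals
      (intervalIntegrable_of_continuousOn_Ioi hHρ hδ hM)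
      (intervalIntegrable_of_continuousOn_Ioi hHρ hM (hM.trans_le hx))]
  -- The free constant `κ` is chosen so that beyond `M` the solution is `-D v (T - R)`, a multiple
  -- of the decreasing solution; this keeps `u` bounded at infinity.
  set D := (J M - H M * R M) / T with hD
  set κ := H M + D with hκ
  set U := fun x => κ * R x - J x with hU
  set u := fun x => v x * U x with hu
  set qu := fun x => q x * U x + (κ - H x) / v x with hqu
  have hUd : ∀ x, 0 < x → HasDerivAt U ((κ - H x) * ρ x) x := fun x hx =>
    (((hRd x hx).const_mul κ).sub (hJd x hx)).congr_deriv (by simp only [hρ]; ring)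
  have hud : ∀ x, 0 < x → HasDerivAt u (scaleDeriv b σ x * qu x) x := fun x hx => by
    refine ((hv.deriv_v x hx).mul (hUd x hx)).congr_deriv ?_
    have := (hv.v_pos hx).ne'
    simp only [hρ, hqu]
    field_simp
  have hqud : ∀ x, 0 < x → HasDerivAt qu ((r x * u x - g x) * speedDensity b σ x) x :=
    fun x hx => by
    refine (((hv.deriv_q x hx).mul (hUd x hx)).add (((hHd x hx).const_sub κ).div
      (hv.deriv_v x hx) (hv.v_pos hx).ne')).congr_deriv ?_
    have := (hv.v_pos hx).ne'
    simp only [hρ, hu]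
    field_simp
    ring
  have huc : ContinuousOn u (Ioi 0) := fun x hx => (hud x hx).continuousAt.continuousWithinAt
  have hfc : ContinuousOn (fun x => r x * u x - g x) (Ioi 0) :=
    (h.continuousOn_r.mul huc).sub hg.continuousOn
  have hul : ∀ x, 0 < x → x ≤ δ → u x = κ * (v x * R x) := fun x hx hxδ => by
    simp only [hu, hU, hJl x hx hxδ]; ring
  have hur : ∀ x, M ≤ x → u x = -D * (v x * (T - R x)) := fun x hx => by
    have : J M - H M * R M = D * T := by rw [hD]; field_simp
    simp only [hu, hU, hJr x hx, hκ]
    linear_combination -v x * this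
  -- The cut points stay on either side of `1`, where `q` vanishes and the bounds `1 / (-q)` and `1
  -- / q` are lost.
  set a := min δ (1 / 2) with ha
  set c := max M 2 with hc
  have ha0 : 0 < a := lt_min hδ (by norm_num)
  have hbl : ∀ x, 0 < x → x ≤ a → |u x| ≤ |κ| * (1 / (-q a)) := fun x hx hxa => by
    have ha1 : a < 1 := (min_le_right _ _).trans_lt (by norm_num)
    rw [hul x hx (hxa.trans (min_le_left _ _)), abs_mul,
      abs_of_nonneg (mul_pos (hv.v_pos hx) (hR0 x hx)).le]
    refine mul_le_mul_of_nonneg_left ((hRl x hx (hxa.trans_lt ha1)).trans ?_) (abs_nonneg _)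
    exact one_div_le_one_div_of_le (neg_pos.2 (hv.q_neg h ha0 ha1))
      (neg_le_neg ((hv.strictMonoOn_q h).monotoneOn hx ha0 hxa))
  have hbr : ∀ x, c ≤ x → |u x| ≤ |D| * (1 / q c) := fun x hxc => by
    have hc1 : 1 < c := lt_of_lt_of_le (by norm_num) (le_max_right _ _)
    have hx1 : 1 < x := hc1.trans_le hxc
    have hx0 : 0 < x := one_pos.trans hx1
    rw [hur x ((le_max_left _ _).trans hxc), abs_mul, abs_neg,
      abs_of_nonneg (mul_nonneg (hv.v_pos hx0).le (sub_nonneg.2 (hRT x hx0)))]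
    refine mul_le_mul_of_nonneg_left ((hRr x hx1).trans ?_) (abs_nonneg _)
    exact one_div_le_one_div_of_le (hv.q_pos h hc1)
      ((hv.strictMonoOn_q h).monotoneOn (one_pos.trans hc1 : 0 < c) hx0 hxc)
  obtain ⟨K, hK⟩ := isCompact_Icc.exists_bound_of_continuousOn
    (huc.mono (fun y hy => ha0.trans_le hy.1 : Icc a c ⊆ Ioi 0))
  have hub : ∀ x, 0 < x → |u x| ≤ max K (max (|κ| * (1 / (-q a))) (|D| * (1 / q c))) := by
    intro x hx
    rcases le_total x a with h1 | h1
    · exact (hbl x hx h1).trans ((le_max_left _ _).trans (le_max_right _ _))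
    · rcases le_total c x with h2 | h2
      · exact (hbr x h2).trans ((le_max_right _ _).trans (le_max_right _ _))
      · exact (hK x ⟨h1, h2⟩).trans (le_max_left _ _)
  refine ⟨κ, fun x hx hxδ G hG => ?_⟩
  rw [← hul x hx hxδ]
  refine hG.integral_eq_of_bounded h hx (h.contDiffOn_two hfc hud hqud) hub hg.continuousOn
    (fun y _ => hB y) fun y hy => ?_
  rw [h.generator_eq hud hqud hy]
  ring

end IsFundamental

/-! ### The squeeze at a natural boundary -/

variable {b σ r : ℝ → ℝ}

/-- If `0` is natural, the Green measures started from `x ≤ δ` are, on `]δ,∞[`, multiples of the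
Green measure started from `δ`, with a factor that vanishes as `x ↓ 0`. -/
theorem Admissible.exists_restrict_eq_smul (h : Admissible b σ r) (hnat : ZeroNatural b σ) :
    ∃ ψ : ℝ → ℝ, (∀ x, 0 < x → 0 < ψ x) ∧ Tendsto ψ (𝓝[>] 0) (𝓝 0) ∧
      ∀ δ x, 0 < x → x ≤ δ → ∀ G G', IsGreenMeasure b σ r x G → IsGreenMeasure b σ r δ G' →
        G.restrict (Ioi δ) = ENNReal.ofReal (ψ x / ψ δ) • G'.restrict (Ioi δ) := by
  obtain ⟨v, q, hv⟩ := h.exists_isFundamental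
  obtain ⟨R, T, hT, hRd, hR0, hRT, hRl, hRr⟩ := hv.exists_primitive h
  have hψ0 : ∀ x, 0 < x → 0 < v x * R x := fun x hx => mul_pos (hv.v_pos hx) (hR0 x hx)
  refine ⟨fun x => v x * R x, hψ0, ?_, ?_⟩
  · have hlim := (hv.tendsto_neg_q h hnat).inv_tendsto_atTop
    refine squeeze_zero' ?_ ?_ hlim
    · filter_upwards [self_mem_nhdsWithin] with x hx using (hψ0 x hx).le
    · filter_upwards [Ioo_mem_nhdsGT one_pos] with x hx
      have := hRl x hx.1 hx.2
      rwa [one_div] at this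
  · intro δ x hx hxδ G G' hG hG'
    have hδ : 0 < δ := hx.trans_le hxδ
    have := hG.finite
    have := hG'.finite
    have hfin : IsFiniteMeasure (ENNReal.ofReal (v x * R x / (v δ * R δ)) • G'.restrict (Ioi δ)) :=
      Measure.smul_finite _ ENNReal.ofReal_ne_top
    refine ext_of_forall_integral_eq_of_IsFiniteMeasure fun f => ?_
    -- Continuous cut-offs supported in `[δ, δ + n]` that converge pointwise to the indicator of
    -- `]δ,∞[`; they reduce the comparison of measures to compactly supported integrands.
    let k : ℕ → ℝ → ℝ := fun n y => max 0 (min 1 (min (n * (y - δ)) (δ + n - y)))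
    have hk0 : ∀ n y, 0 ≤ k n y := fun n y => le_max_left _ _
    have hk1 : ∀ n y, k n y ≤ 1 := fun n y => max_le zero_le_one (min_le_left _ _)
    have hkc : ∀ n, Continuous (k n) := fun n => by fun_prop
    have hkl : ∀ n y, y ≤ δ → k n y = 0 := fun n y hy =>
      max_eq_left ((min_le_right _ _).trans ((min_le_left _ _).trans
        (mul_nonpos_of_nonneg_of_nonpos (Nat.cast_nonneg n) (sub_nonpos.2 hy))))
    have hkr : ∀ (n : ℕ) (y : ℝ), δ + n ≤ y → k n y = 0 := fun n y hy =>
      max_eq_left ((min_le_right _ _).trans ((min_le_right _ _).trans (sub_nonpos.2 hy)))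
    have hklim : ∀ y, Tendsto (fun n => k n y) atTop (𝓝 ((Ioi δ).indicator (fun _ => 1) y)) := by
      intro y
      by_cases hy : y ∈ Ioi δ
      · rw [indicator_of_mem hy]
        have hyδ : 0 < y - δ := sub_pos.2 hy
        refine tendsto_const_nhds.congr' ?_
        filter_upwards [(tendsto_natCast_atTop_atTop (R := ℝ)).eventually_ge_atTop (1 / (y - δ)),
          (tendsto_natCast_atTop_atTop (R := ℝ)).eventually_ge_atTop (1 + y - δ)] with n h1 h2
        rw [div_le_iff₀ hyδ] at h1
        symm
        simp only [k]
        rw [min_eq_left (le_min h1 (by linarith)), max_eq_right zero_le_one]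
      · rw [indicator_of_notMem hy]
        exact tendsto_const_nhds.congr fun n => (hkl n y (not_lt.1 hy)).symm
    have hlim : ∀ (μ : Measure ℝ) [IsFiniteMeasure μ],
        Tendsto (fun n => ∫ y, k n y * f y ∂μ) atTop (𝓝 (∫ y in Ioi δ, f y ∂μ)) := by
      intro μ _
      rw [← integral_indicator measurableSet_Ioi]
      refine tendsto_integral_of_dominated_convergence (fun _ => ‖f‖)
        (fun n => ((hkc n).mul f.continuous).aestronglyMeasurable) (integrable_const _)
        (fun n => Eventually.of_forall fun y => ?_) (Eventually.of_forall fun y => ?_)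
      · rw [norm_mul, Real.norm_of_nonneg (hk0 n y)]
        exact (mul_le_of_le_one_left (norm_nonneg _) (hk1 n y)).trans (f.norm_coe_le_norm y)
      · have := (hklim y).mul_const (f y)
        by_cases hy : y ∈ Ioi δ <;> simpa [hy] using this
    have heq : ∀ n, ∫ y, k n y * f y ∂G
        = (v x * R x / (v δ * R δ)) * ∫ y, k n y * f y ∂G' := by
      intro n
      -- The same `κ` serves both starting points `x` and `δ`, so it drops out of the ratio.
      obtain ⟨κ, hκ⟩ := hv.exists_integral_eq h hT hRd hR0 hRT hRl hRr hδ
        (le_add_of_nonneg_right (Nat.cast_nonneg n) : δ ≤ δ + n)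
        (g := fun y => k n y * f y) ((hkc n).mul f.continuous) (B := ‖f‖)
        (fun y => by
          rw [abs_mul, abs_of_nonneg (hk0 n y)]
          exact (mul_le_of_le_one_left (norm_nonneg _) (hk1 n y)).trans (f.norm_coe_le_norm y))
        (fun y hy => by simp [hkl n y hy]) (fun y hy => by simp [hkr n y hy])
      rw [hκ x hx hxδ G hG, hκ δ hδ le_rfl G' hG']
      rw [div_mul_eq_mul_div, eq_div_iff (hψ0 δ hδ).ne']
      ring
    rw [integral_smul_measure, ENNReal.toReal_ofReal (div_pos (hψ0 x hx) (hψ0 δ hδ)).le,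
      smul_eq_mul]
    exact tendsto_nhds_unique (hlim G) (((hlim G').const_mul _).congr fun n => (heq n).symm)

/-- For real `z` below the liminf of `F/r`, write `∫ F dG_x - z = ∫ (F - z r) dG_x`, using `∫ r dG_x
= 1`. The part near `0` is nonnegative; the part on `]δ,∞[` is a fixed number times `ψ(x)/ψ(δ) → 0`.
Integrability of `F` against `G_δ` is all that is used far from `0`, so no growth bound on `F`
enters. -/
theorem liminf_div_le_liminf_integral (h : Admissible b σ r) (hnat : ZeroNatural b σ) {F : ℝ → ℝ}
    {G : ℝ → Measure ℝ} (hG : ∀ x, 0 < x → IsGreenMeasure b σ r x (G x))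
    (hF : ∀ x, 0 < x → Integrable F (G x)) :
    liminf (fun x => ((F x / r x : ℝ) : EReal)) (𝓝[>] (0 : ℝ))
      ≤ liminf (fun x => ((∫ y, F y ∂(G x) : ℝ) : EReal)) (𝓝[>] (0 : ℝ)) := by
  obtain ⟨r₀, hr₀, hr⟩ := h.r_lower
  obtain ⟨r₁, hr₁⟩ := h.r_upper
  obtain ⟨ψ, hψ0, hψ, hres⟩ := h.exists_restrict_eq_smul hnat
  rw [← EReal.ge_of_forall_gt_iff_ge]
  intro z hz
  have hev := eventually_lt_of_lt_liminf hz
  obtain ⟨δ', hδ', hlt⟩ := mem_nhdsGT_iff_exists_Ioo_subset.1 hev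
  have hδ'0 : 0 < δ' := hδ'
  -- Halving puts the endpoint `δ` itself inside the interval where `F/r > z`.
  set δ := δ' / 2 with hδdef
  have hδ : 0 < δ := half_pos hδ'0
  set K := ∫ y in Ioi δ, (F y - z * r y) ∂(G δ) with hK
  have hlow : ∀ x, 0 < x → x ≤ δ → z + ψ x / ψ δ * K ≤ ∫ y, F y ∂(G x) := by
    intro x hx hxδ
    have hri : Integrable r (G x) := (hG x hx).integrable_of_bounded h.continuousOn_r (N := r₁)
      fun y hy => by
        rw [abs_of_nonneg (hr₀.le.trans (hr y hy.le))]; exact hr₁ y hy.le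
    have hi : Integrable (fun y => F y - z * r y) (G x) := (hF x hx).sub (hri.const_mul z)
    have h1 : ∫ y, (F y - z * r y) ∂(G x) = ∫ y, F y ∂(G x) - z := by
      rw [integral_sub (hF x hx) (hri.const_mul z), integral_const_mul, (hG x hx).rate, mul_one]
    have h2 := integral_add_compl (measurableSet_Ioi (a := δ)) hi
    have h3 : ∫ y in Ioi δ, (F y - z * r y) ∂(G x) = ψ x / ψ δ * K := by
      rw [hres δ x hx hxδ _ _ (hG x hx) (hG δ hδ), integral_smul_measure,
        ENNReal.toReal_ofReal (div_pos (hψ0 x hx) (hψ0 δ hδ)).le, smul_eq_mul]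
    have h4 : 0 ≤ ∫ y in (Ioi δ)ᶜ, (F y - z * r y) ∂(G x) := by
      refine setIntegral_nonneg_of_ae_restrict ?_
      filter_upwards [ae_restrict_mem measurableSet_Ioi.compl,
        ae_restrict_of_ae (hG x hx).pos] with y hy hy0
      have hyδ : y ≤ δ := not_lt.1 hy
      have h5 : ((z : ℝ) : EReal) < ((F y / r y : ℝ) : EReal) :=
        hlt ⟨hy0, hyδ.trans_lt (half_lt_self hδ'0)⟩
      rw [EReal.coe_lt_coe_iff, lt_div_iff₀ (hr₀.trans_le (hr y hy0.le))] at h5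
      exact sub_nonneg.2 h5.le
    linarith
  have hlim : Tendsto (fun x => ((z + ψ x / ψ δ * K : ℝ) : EReal)) (𝓝[>] 0) (𝓝 (z : EReal)) := by
    refine (continuous_coe_real_ereal.tendsto z).comp ?_
    have := ((hψ.div_const (ψ δ)).mul_const K).const_add z
    simpa using this
  rw [← hlim.liminf_eq]
  refine liminf_le_liminf ?_
  filter_upwards [Ioc_mem_nhdsGT hδ] with x hx
  exact EReal.coe_le_coe_iff.2 (hlow x hx.1 hx.2)

theorem squeezedAtZero_integral (h : Admissible b σ r) (hnat : ZeroNatural b σ) {F : ℝ → ℝ}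
    {G : ℝ → Measure ℝ} (hG : ∀ x, 0 < x → IsGreenMeasure b σ r x (G x))
    (hF : ∀ x, 0 < x → Integrable F (G x)) :
    SqueezedAtZero (fun x => F x / r x) (fun x => ∫ y, F y ∂(G x)) := by
  refine ⟨liminf_div_le_liminf_integral h hnat hG hF, liminf_le_limsup, ?_⟩
  have key := liminf_div_le_liminf_integral h hnat (F := -F) hG fun x hx => (hF x hx).neg
  have e1 : (fun x => (((-F) x / r x : ℝ) : EReal)) = -fun x => ((F x / r x : ℝ) : EReal) := by
    funext x
    simp [neg_div]
  have e2 : (fun x => ((∫ y, (-F) y ∂(G x) : ℝ) : EReal))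
      = -fun x => ((∫ y, F y ∂(G x) : ℝ) : EReal) := by
    funext x
    simp [integral_neg]
  rw [e1, e2, EReal.liminf_neg, EReal.liminf_neg] at key
  exact EReal.neg_le_neg_iff.1 key

/-! ### The counterexample with an entrance boundary -/

section EntranceExample

theorem lintegral_ofReal_eq_top {g : ℝ → ℝ} {s : Set ℝ} (hg : Measurable g) (hs : MeasurableSet s)
    (h0 : ∀ x ∈ s, 0 ≤ g x) (hi : ¬ IntegrableOn g s) : ∫⁻ x in s, ENNReal.ofReal (g x) = ⊤ := by
  by_contra hne
  refine hi ⟨hg.aestronglyMeasurable, ?_⟩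
  rw [hasFiniteIntegral_iff_ofReal
    (by filter_upwards [ae_restrict_mem hs] with x hx using h0 x hx)]
  exact lt_top_iff_ne_top.2 hne

theorem scaleDeriv_one_add {x : ℝ} (hx : 0 < x) :
    scaleDeriv (fun x => 1 + x) (fun x => x) x = Real.exp (2 / x - 2) / x ^ 2 := by
  have hint : ∫ s in (1 : ℝ)..x, (1 + s) / s ^ 2 = (Real.log x - x⁻¹) - (Real.log 1 - 1⁻¹) := by
    refine intervalIntegral.integral_eq_sub_of_hasDerivAt (f := fun s => Real.log s - s⁻¹)
      (fun s hs => ?_) ?_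
    · have hs0 : s ≠ 0 := (uIcc_subset_Ioi_zero one_pos hx hs).ne'
      refine ((Real.hasDerivAt_log hs0).sub (hasDerivAt_inv hs0)).congr_deriv ?_
      field_simp
      ring
    · refine intervalIntegrable_of_continuousOn_Ioi ?_ one_pos hx
      exact ContinuousOn.div (by fun_prop) (by fun_prop) fun s hs => pow_ne_zero 2 (ne_of_gt hs)
  rw [scaleDeriv, hint, Real.log_one,
    show -2 * (Real.log x - x⁻¹ - (0 - 1⁻¹)) = (2 / x - 2) - (2 : ℕ) * Real.log x by
      push_cast; ring, Real.exp_sub, Real.exp_nat_mul, Real.exp_log hx]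

theorem speedDensity_one_add {x : ℝ} (hx : 0 < x) :
    2 / (x ^ 2 * scaleDeriv (fun x => 1 + x) (fun x => x) x) = 2 * Real.exp (2 - 2 / x) := by
  rw [scaleDeriv_one_add hx, show 2 - 2 / x = -(2 / x - 2) by ring, Real.exp_neg]
  have := (Real.exp_pos (2 / x - 2)).ne'
  field_simp

theorem scale_one_add {x : ℝ} (hx : 0 < x) :
    scale (fun x => 1 + x) (fun x => x) x = (1 - Real.exp (2 / x - 2)) / 2 := by
  have hd : ∀ s, 0 < s → HasDerivAt (fun s => (1 - Real.exp (2 / s - 2)) / 2)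
      (Real.exp (2 / s - 2) / s ^ 2) s := fun s hs => by
    have h1 : HasDerivAt (fun s : ℝ => 2 / s - 2) (-2 / s ^ 2) s := by
      refine (((hasDerivAt_inv hs.ne').const_mul 2).sub_const 2).congr_deriv ?_
      ring
    refine ((h1.exp.const_sub 1).div_const 2).congr_deriv ?_
    ring
  have hc : ContinuousOn (fun s => Real.exp (2 / s - 2) / s ^ 2) (Ioi 0) := by
    refine ContinuousOn.div (Real.continuous_exp.comp_continuousOn ?_) (by fun_prop)
      fun s hs => pow_ne_zero 2 (ne_of_gt hs)
    exact (continuousOn_const.div continuousOn_id fun s hs => ne_of_gt hs).sub continuousOn_const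
  rw [scale, intervalIntegral.integral_congr (g := fun s => Real.exp (2 / s - 2) / s ^ 2)
    fun s hs => scaleDeriv_one_add (uIcc_subset_Ioi_zero one_pos hx hs),
    intervalIntegral.integral_eq_sub_of_hasDerivAt
    (fun s hs => hd s (uIcc_subset_Ioi_zero one_pos hx hs))
    (intervalIntegrable_of_continuousOn_Ioi hc one_pos hx)]
  norm_num

theorem le_speedMeasure_one_add {a c K : ℝ} (ha : 0 ≤ a)
    (hK : ∀ x ∈ Ioo a c, K ≤ 2 * Real.exp (2 - 2 / x)) :
    ENNReal.ofReal K * ENNReal.ofReal (c - a)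
      ≤ speedMeasure (fun x => 1 + x) (fun x => x) (Ioo a c) := by
  have hsub : Ioo a c ⊆ Ioi 0 := fun x hx => ha.trans_lt hx.1
  rw [speedMeasure, withDensity_apply _ measurableSet_Ioo,
    Measure.restrict_restrict measurableSet_Ioo, inter_eq_self_of_subset_left hsub,
    ← Real.volume_Ioo, ← setLIntegral_const]
  refine setLIntegral_mono' measurableSet_Ioo fun x hx => ENNReal.ofReal_le_ofReal ?_
  rw [speedDensity_one_add (hsub hx)]
  exact hK x hx

/-- On `]0,1/2[` one has `p'(y) ≥ 1/y` and `m(]y,1[) ≥ m(]1/2,1[) ≥ e^{-2}`, and `1/y` is not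
integrable at `0`. -/
theorem zeroInaccessible_one_add : ZeroInaccessible (fun x => 1 + x) (fun x => x) := by
  have hni : ¬ IntegrableOn (fun y : ℝ => Real.exp (-2) * y⁻¹) (Ioo 0 (1 / 2)) := by
    intro hi
    have h1 : IntegrableOn (fun y : ℝ => y⁻¹) (Ioo 0 (1 / 2)) := by
      refine (hi.const_mul (Real.exp 2)).congr (Eventually.of_forall fun y => ?_)
      simp only [← mul_assoc, ← Real.exp_add]
      norm_num
    have h2 : IntervalIntegrable (fun y : ℝ => y⁻¹) volume 0 (1 / 2) := by
      rwa [intervalIntegrable_iff_integrableOn_Ioo_of_le (by norm_num)]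
    rw [intervalIntegrable_inv_iff] at h2
    norm_num at h2
  have htop := lintegral_ofReal_eq_top (by fun_prop) measurableSet_Ioo
    (fun y hy => mul_nonneg (Real.exp_pos _).le (inv_nonneg.2 hy.1.le)) hni
  rw [ZeroInaccessible, eq_top_iff, ← htop]
  refine (setLIntegral_mono' measurableSet_Ioo fun y hy => ?_).trans
    (lintegral_mono_set (Ioo_subset_Ioo_right (by norm_num)))
  have hsm : ENNReal.ofReal (Real.exp (-2)) ≤ speedMeasure (fun x => 1 + x) (fun x => x)
      (Ioo y 1) := by
    refine le_trans ?_ ((le_speedMeasure_one_add (a := 1 / 2) (c := 1) (K := 2 * Real.exp (-2))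
      (by norm_num) fun x hx => ?_).trans (measure_mono (Ioo_subset_Ioo_left hy.2.le)))
    · rw [← ENNReal.ofReal_mul (by positivity)]
      refine ENNReal.ofReal_le_ofReal (le_of_eq ?_)
      ring
    · have hx0 : 0 < x := lt_trans (by norm_num) hx.1
      gcongr
      have : 2 / x ≤ 4 := by
        rw [div_le_iff₀ hx0]; linarith [hx.1]
      linarith
  have hp : y⁻¹ ≤ scaleDeriv (fun x => 1 + x) (fun x => x) y := by
    rw [scaleDeriv_one_add hy.1, inv_eq_one_div, div_le_div_iff₀ hy.1 (pow_pos hy.1 2)]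
    have h2 : 1 ≤ Real.exp (2 / y - 2) := by
      rw [Real.one_le_exp_iff, sub_nonneg, le_div_iff₀ hy.1]
      linarith [hy.2]
    nlinarith [hy.1, hy.2]
  rw [mul_comm, ENNReal.ofReal_mul (inv_nonneg.2 hy.1.le)]
  exact mul_le_mul' (ENNReal.ofReal_le_ofReal hp) hsm

/-- For `y > 2`, `p'(y) ≥ e^{-2}/y²` and `m(]1,y[) ≥ 2 (y - 1) ≥ y`, so the integrand dominates a
multiple of `1/y`. -/
theorem inftyInaccessible_one_add : InftyInaccessible (fun x => 1 + x) (fun x => x) := by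
  have hni : ¬ IntegrableOn (fun y : ℝ => Real.exp (-2) * y⁻¹) (Ioi 2) := by
    intro hi
    refine not_integrableOn_Ioi_inv (a := 2) ?_
    refine (hi.const_mul (Real.exp 2)).congr (Eventually.of_forall fun y => ?_)
    simp only [← mul_assoc, ← Real.exp_add]
    norm_num
  have htop := lintegral_ofReal_eq_top (by fun_prop) measurableSet_Ioi
    (fun y hy => mul_nonneg (Real.exp_pos _).le
      (inv_nonneg.2 (two_pos.trans (show (2 : ℝ) < y from hy)).le)) hni
  rw [InftyInaccessible, eq_top_iff, ← htop]
  refine (setLIntegral_mono' measurableSet_Ioi fun y hy => ?_).trans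
    (lintegral_mono_set (Ioi_subset_Ioi (by norm_num)))
  have hy2 : 2 < y := hy
  have hy0 : 0 < y := two_pos.trans hy2
  have hsm : ENNReal.ofReal y ≤ speedMeasure (fun x => 1 + x) (fun x => x) (Ioo 1 y) := by
    refine le_trans ?_ (le_speedMeasure_one_add (K := 2) zero_le_one fun x hx => ?_)
    · rw [← ENNReal.ofReal_mul two_pos.le]
      exact ENNReal.ofReal_le_ofReal (by linarith)
    · have hx0 : 0 < x := one_pos.trans hx.1
      have : 1 ≤ Real.exp (2 - 2 / x) := by
        rw [Real.one_le_exp_iff, sub_nonneg, div_le_iff₀ hx0]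
        linarith [hx.1]
      linarith
  have hp : Real.exp (-2) / y ^ 2 ≤ scaleDeriv (fun x => 1 + x) (fun x => x) y := by
    rw [scaleDeriv_one_add hy0]
    have : 0 < 2 / y := by positivity
    gcongr
    linarith
  refine le_trans (le_of_eq ?_) (mul_le_mul' (ENNReal.ofReal_le_ofReal hp) hsm)
  rw [← ENNReal.ofReal_mul (by positivity)]
  congr 1
  field_simp

theorem admissible_one_add : Admissible (fun x => 1 + x) (fun x => x) (fun _ => 1) where
  b_lip := (show ContDiff ℝ 1 fun x : ℝ => 1 + x by fun_prop).locallyLipschitz.locallyLipschitzOn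
  σ_lip := LocallyLipschitz.id.locallyLipschitzOn
  σ_pos := fun _ hx => hx
  r_cont := continuousOn_const
  r_lower := ⟨1, one_pos, fun _ _ => le_rfl⟩
  r_upper := ⟨1, fun _ _ => le_rfl⟩
  zero_inaccessible := zeroInaccessible_one_add
  infty_inaccessible := inftyInaccessible_one_add

/-- In closed form `(p(1) - p(y)) m'(y) = 1 - e^{2 - 2/y} ≤ 1`: the explosion of the scale function
is offset by the decay of the speed density. -/
theorem zeroEntrance_one_add : ZeroEntrance (fun x => 1 + x) (fun x => x) := by
  refine ⟨zeroInaccessible_one_add, ?_⟩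
  have hsub : Ioo (0 : ℝ) 1 ⊆ Ioi 0 := fun x hx => hx.1
  have hm : AEMeasurable (fun x => ENNReal.ofReal
      (2 / (x ^ 2 * scaleDeriv (fun x => 1 + x) (fun x => x) x)))
      (volume.restrict (Ioo (0 : ℝ) 1)) :=
    ((admissible_one_add.continuousOn_speedDensity.mono hsub).aemeasurable
      measurableSet_Ioo).ennreal_ofReal
  rw [speedMeasure, restrict_withDensity measurableSet_Ioo,
    Measure.restrict_restrict measurableSet_Ioo, inter_eq_self_of_subset_left hsub,
    lintegral_withDensity_eq_lintegral_mul_non_measurable₀ _ hm (by simp)]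
  calc _ ≤ ∫⁻ _ in Ioo (0 : ℝ) 1, 1 := by
        refine setLIntegral_mono' measurableSet_Ioo fun y hy => ?_
        simp only [Pi.mul_apply]
        rw [speedDensity_one_add hy.1, scale_one_add hy.1, scale_one_add one_pos,
          ← ENNReal.ofReal_mul (by positivity), ← ENNReal.ofReal_one]
        refine ENNReal.ofReal_le_ofReal ?_
        have h1 : Real.exp (2 - 2 / y) * Real.exp (2 / y - 2) = 1 := by
          rw [← Real.exp_add]; simp
        have h2 := Real.exp_pos (2 - 2 / y)
        norm_num
        nlinarith
    _ < ⊤ := by simp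

theorem sub_generator_one_add {x : ℝ} (hx : 0 < x) :
    1 * (1 / (1 + x)) - generator (fun x => 1 + x) (fun x => x) (fun x => 1 / (1 + x)) x
      = 2 / (1 + x) - x ^ 2 / (1 + x) ^ 3 := by
  have hd : ∀ y : ℝ, 0 < y → HasDerivAt (fun x : ℝ => 1 / (1 + x)) (-1 / (1 + y) ^ 2) y :=
    fun y hy => by
    have hy' : 1 + y ≠ 0 := by positivity
    refine ((hasDerivAt_const y (1 : ℝ)).div ((hasDerivAt_id y).const_add 1) hy').congr_deriv ?_
    simp
  have hd2 : HasDerivAt (deriv fun x : ℝ => 1 / (1 + x)) (2 / (1 + x) ^ 3) x := by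
    have hx' : 1 + x ≠ 0 := by positivity
    have h1 : HasDerivAt (fun y : ℝ => -1 / (1 + y) ^ 2) (2 / (1 + x) ^ 3) x := by
      refine ((hasDerivAt_const x (-1 : ℝ)).div (((hasDerivAt_id x).const_add 1).pow 2)
        (pow_ne_zero 2 hx')).congr_deriv ?_
      simp only [id, Pi.pow_apply]
      field_simp
      ring
    refine h1.congr_of_eventuallyEq ?_
    filter_upwards [Ioi_mem_nhds hx] with y hy using (hd y hy).deriv
  rw [generator, hd2.deriv, (hd x hx).deriv]
  have hx' : 1 + x ≠ 0 := by positivity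
  field_simp
  ring

/-- Uniqueness of bounded solutions applied to `u = 1/(1+x)`, whose right-hand side `u - L u` is
bounded. Its drift term `(1 + x) u'` tends to `-1` at `0`, which separates `u - L u` from `u` in the
limit. -/
theorem integral_green_one_add {x : ℝ} (hx : 0 < x) {G : Measure ℝ}
    (hG : IsGreenMeasure (fun x => 1 + x) (fun x => x) (fun _ => 1) x G) :
    Integrable (fun y => 2 / (1 + y) - y ^ 2 / (1 + y) ^ 3) G ∧
    ∫ y, (2 / (1 + y) - y ^ 2 / (1 + y) ^ 3) ∂G = 1 / (1 + x) := by
  have hne : ∀ y ∈ Ioi (0 : ℝ), 1 + y ≠ 0 := fun y hy => (add_pos one_pos hy).ne'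
  have hc : ContinuousOn (fun y : ℝ => 2 / (1 + y) - y ^ 2 / (1 + y) ^ 3) (Ioi 0) :=
    (ContinuousOn.div (by fun_prop) (by fun_prop) hne).sub
      (ContinuousOn.div (by fun_prop) (by fun_prop) fun y hy => pow_ne_zero 3 (hne y hy))
  have hb : ∀ y : ℝ, 0 < y → |2 / (1 + y) - y ^ 2 / (1 + y) ^ 3| ≤ 2 := by
    intro y hy
    have h1 : 0 ≤ 2 / (1 + y) := by positivity
    have h2 : 2 / (1 + y) ≤ 2 := div_le_self two_pos.le (by linarith)
    have h3 : 0 ≤ y ^ 2 / (1 + y) ^ 3 := by positivity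
    have h4 : y ^ 2 / (1 + y) ^ 3 ≤ 1 := by
      rw [div_le_one (by positivity)]
      nlinarith [pow_pos hy 3]
    rw [abs_le]
    constructor <;> linarith
  refine ⟨hG.integrable_of_bounded hc hb, ?_⟩
  refine hG.integral_eq_of_bounded admissible_one_add hx (u := fun x => 1 / (1 + x)) (M := 1)
    (contDiffOn_const.div (by fun_prop) hne) (fun y hy => ?_) hc hb
    fun y hy => sub_generator_one_add hy
  rw [abs_of_pos (by positivity), div_le_one (by positivity)]
  linarith

end EntranceExample

theorem SqueezedAtZero.congr {g R R' : ℝ → ℝ} (h : SqueezedAtZero g R)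
    (hR : ∀ x, 0 < x → R' x = R x) : SqueezedAtZero g R' := by
  have hev : (fun x => (R' x : EReal)) =ᶠ[𝓝[>] (0 : ℝ)] fun x => (R x : EReal) := by
    filter_upwards [self_mem_nhdsWithin] with x hx
    rw [hR x hx]
  unfold SqueezedAtZero
  rw [liminf_congr hev, limsup_congr hev]
  exact h

end PosDiffusion

/-! ### Assembly of the three statements -/

theorem mainTheorem8 :
    (∀ (b σ r F : ℝ → ℝ), PosDiffusion.Admissible b σ r →
      Measurable (fun x : Set.Ioi (0 : ℝ) => F x) →
      ∀ (Ω : Type u) (mΩ : MeasurableSpace Ω)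
        (𝓕 : ℝ → Filtration ℝ≥0 mΩ)
        (P : ℝ → Measure Ω) (X : ℝ → ℝ≥0 → Ω → ℝ),
        PosDiffusion.IsDiffusionFamily b σ 𝓕 P X →
        PosDiffusion.DiscountedIntegrable r F P X →
        (∀ K : ℝ, (∀ x, 0 < x → K ≤ F x / r x) →
          ∀ x, 0 < x → K ≤ PosDiffusion.resolvent r F P X x) ∧
        (PosDiffusion.ZeroNatural b σ →
          PosDiffusion.SqueezedAtZero (fun x => F x / r x) (PosDiffusion.resolvent r F P X))) ∧
    (∃ (b σ r F : ℝ → ℝ), PosDiffusion.Admissible b σ r ∧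
      Measurable (fun x : Set.Ioi (0 : ℝ) => F x) ∧
      PosDiffusion.ZeroEntrance b σ ∧
      ∀ (Ω : Type u) (mΩ : MeasurableSpace Ω)
        (𝓕 : ℝ → Filtration ℝ≥0 mΩ)
        (P : ℝ → Measure Ω) (X : ℝ → ℝ≥0 → Ω → ℝ),
        PosDiffusion.IsDiffusionFamily b σ 𝓕 P X →
        PosDiffusion.DiscountedIntegrable r F P X ∧
        ¬ PosDiffusion.SqueezedAtZero (fun x => F x / r x)
            (PosDiffusion.resolvent r F P X)) := by
  refine ⟨fun b σ r F h hF Ω mΩ 𝓕 P X hX hD => ?_, ?_⟩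
  · have hG : ∀ x, 0 < x →
        PosDiffusion.IsGreenMeasure b σ r x (PosDiffusion.greenMeasure r (P x) (X x)) :=
      fun x hx => (hX x hx).isGreenMeasure h
    have hi : ∀ x, 0 < x → Integrable F (PosDiffusion.greenMeasure r (P x) (X x)) := fun x hx =>
      ((hX x hx).integrable_greenMeasure_iff h.continuousOn_r hF).2 (hD x hx)
    have hR : ∀ x, 0 < x → PosDiffusion.resolvent r F P X x
        = ∫ y, F y ∂(PosDiffusion.greenMeasure r (P x) (X x)) := fun x hx =>
      ((hX x hx).integral_greenMeasure h.continuousOn_r hF (hi x hx)).symm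
    refine ⟨fun K hK x hx => ?_, fun hnat =>
      (PosDiffusion.squeezedAtZero_integral h hnat hG hi).congr hR⟩
    obtain ⟨r₀, hr₀, hr⟩ := h.r_lower
    obtain ⟨r₁, hr₁⟩ := h.r_upper
    have hri : Integrable r (PosDiffusion.greenMeasure r (P x) (X x)) :=
      (hG x hx).integrable_of_bounded h.continuousOn_r (N := r₁) fun y hy => by
        rw [abs_of_nonneg (hr₀.le.trans (hr y hy.le))]; exact hr₁ y hy.le
    rw [hR x hx]
    calc K = ∫ y, K * r y ∂(PosDiffusion.greenMeasure r (P x) (X x)) := by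
          rw [integral_const_mul, (hG x hx).rate, mul_one]
      _ ≤ _ := by
          refine integral_mono_ae (hri.const_mul K) (hi x hx) ?_
          filter_upwards [(hG x hx).pos] with y hy
          exact (le_div_iff₀ (hr₀.trans_le (hr y hy.le))).1 (hK y hy)
  · have h := PosDiffusion.admissible_one_add
    have hF : Measurable fun x : Set.Ioi (0 : ℝ) =>
        2 / (1 + (x : ℝ)) - (x : ℝ) ^ 2 / (1 + (x : ℝ)) ^ 3 := by fun_prop
    refine ⟨_, _, _, fun y => 2 / (1 + y) - y ^ 2 / (1 + y) ^ 3, h, hF,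
      PosDiffusion.zeroEntrance_one_add, fun Ω mΩ 𝓕 P X hX => ?_⟩
    have hG := fun x (hx : 0 < x) =>
      PosDiffusion.integral_green_one_add hx ((hX x hx).isGreenMeasure h)
    refine ⟨fun x hx => ((hX x hx).integrable_greenMeasure_iff h.continuousOn_r hF).1 (hG x hx).1,
      fun hS => ?_⟩
    -- Only the first inequality of the chain is contradicted: it would read `2 ≤ 1`.
    have hS' := (hS.congr (R' := fun x => 1 / (1 + x)) fun x hx => by
      rw [← (hG x hx).2]
      exact (hX x hx).integral_greenMeasure h.continuousOn_r hF (hG x hx).1).1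
    have hl1 : Tendsto (fun x : ℝ => ((1 / (1 + x) : ℝ) : EReal)) (𝓝[>] 0) (𝓝 ((1 : ℝ) : EReal)) := by
      refine (continuous_coe_real_ereal.tendsto 1).comp (Tendsto.mono_left ?_ nhdsWithin_le_nhds)
      have : ContinuousAt (fun x : ℝ => 1 / (1 + x)) 0 :=
        ContinuousAt.div (by fun_prop) (by fun_prop) (by norm_num)
      simpa [ContinuousAt] using this
    have hl2 : Tendsto (fun x : ℝ => (((2 / (1 + x) - x ^ 2 / (1 + x) ^ 3) / 1 : ℝ) : EReal))
        (𝓝[>] 0) (𝓝 ((2 : ℝ) : EReal)) := by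
      refine (continuous_coe_real_ereal.tendsto 2).comp (Tendsto.mono_left ?_ nhdsWithin_le_nhds)
      have : ContinuousAt (fun x : ℝ => (2 / (1 + x) - x ^ 2 / (1 + x) ^ 3) / 1) 0 :=
        ((ContinuousAt.div (by fun_prop) (by fun_prop) (by norm_num)).sub
          (ContinuousAt.div (by fun_prop) (by fun_prop) (by norm_num))).div_const 1
      simpa [ContinuousAt] using this
    rw [hl1.liminf_eq, hl2.liminf_eq, EReal.coe_le_coe_iff] at hS'
    norm_num at hS'
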